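/- **Setting.** Vectors live in $\mathbb R^{\mathcal N}$ for a finite ground set $\mathcal N$; $\odot$, $\vee$, $\wedge$ are the coordinate-wise product, maximum and minimum, and $a\oplus b=\mathbf 1-(\mathbf 1-a)\odot(\mathbf 1-b)$. A function $F\colon[0,1]^{\mathcal N}\to\mathbb R$ is DR-submodular if $F(x+r\mathbf 1_u)-F(x)\ge F(y+r\mathbf 1_u)-F(y)$ for all $x\le y$ in $[0,1]^{\mathcal N}$, $u\in\mathcal N$, $0\le r\le 1-y_u$; it is $L$-smooth ($L \geq 0$) if it is differentiable and $\|\nabla F(x)-\nabla F(y)\|_2\le L\|x-y\|_2$ on $[0,1]^{\mathcal N}$. A set $P\subseteq[0,1]^{\mathcal N}$ is down-closed if $0\le x\le y\in P$ implies $x\in P$; a convex body is a non-empty compact convex set, and it has diameter $D$ if $\|x-y\|_2\le D$ for all $x,y\in P$. Algorithms are real-RAM programs with three oracles: evaluation of $F$, evaluation of $\nabla F$, and (meta-solvability of $P$) maximization of a linear function over the intersection of $P$ with finitely many explicitly given linear constraints, which returns a maximizer or reports that the intersection is empty. A call with $k$ linear constraints ($k=0$ for the first two oracles) may take time $(|\mathcal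 N|+k+2)^d$ for an arbitrary fixed $d$. **Theorem.** There is an algorithm FWMCG (one program) and an absolute constant $c>0$ such that the following holds. The input is a non-negative $L$-smooth DR-submodular function $F\colon[0,1]^{\mathcal N}\to\mathbb R_{\ge0}$ and a meta-solvable down-closed convex body $P\subseteq[0,1]^{\mathcal N}$ of diameter $D$ (both given by the oracles; $L$ and $D$ are not given), a vector $z\in P$ and parameters $t_s\in(0,1)$, $\varepsilon\in(0,1/2)$, $\delta\in(0,1)$. The algorithm outputs a vector $y\in P$ and vectors $x_k(i)\in P$ for $1\le k\le K$, $1\le i\le m$, where $$m\le c\,(\delta^{-1}+\varepsilon^{-1}),\qquad K\le c\,\varepsilon^{-3}.$$ For every $o\in P$ that maximizes $F$ over $P$, at least one of the following is true. * $\displaystyle F(y)\ \ge\ e^{-1}\Bigl[\bigl((2-t_s)e^{t_s}-1-c\varepsilon\bigr)F(o)-(e^{t_s}-1)F(z\odot o)-\Bigl((2-t_s)e^{t_s}+t_s-\tfrac{t_s^2+5}{2}\Bigr)F(z\oplus o)\Bigr]-c\,\delta D^2L.$ * There are $k\in[K]$ and $i\in[m]$ such that $x=x_k(i)$ satisfies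 $F(x\oplus o)\le F(z\oplus o)-\varepsilon F(o)$ and $F(x)\ge\frac12\bigl[F(x\vee o)+F(x\wedge o)\bigr]-c\,\varepsilon F(o)-c\,\delta D^2L.$ Moreover, for every $t_s$, $\varepsilon$ and $d$ there are constants $C$ and $p$ such that the running time is at most $C\,(|\mathcal N|+\delta^{-1})^p$ for all other inputs. -/

import Mathlib

/-! ### Vectors, the cube and the objective function -/

namespace FWMCG

/-- `ℝⁿ` with the Euclidean norm; the ground set is `Fin n`. -/
abbrev Vec (n : ℕ) : Type := EuclideanSpace ℝ (Fin n)

/-- The cube `[0,1]ⁿ`. -/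
def cube (n : ℕ) : Set (Vec n) := {x | ∀ u, 0 ≤ x u ∧ x u ≤ 1}

/-- Coordinate-wise product `a ⊙ b`. -/
def hprod {n : ℕ} (a b : Vec n) : Vec n := WithLp.toLp 2 fun u => a u * b u

/-- Coordinate-wise probabilistic sum `a ⊕ b = 1 - (1 - a) ⊙ (1 - b)`. -/
def psum {n : ℕ} (a b : Vec n) : Vec n := WithLp.toLp 2 fun u => 1 - (1 - a u) * (1 - b u)

/-- Coordinate-wise maximum `a ∨ b`. -/
def vmax {n : ℕ} (a b : Vec n) : Vec n := WithLp.toLp 2 fun u => max (a u) (b u)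

/-- Coordinate-wise minimum `a ∧ b`. -/
def vmin {n : ℕ} (a b : Vec n) : Vec n := WithLp.toLp 2 fun u => min (a u) (b u)

/-- Diminishing returns: for `x ≤ y` in the cube and `0 ≤ r ≤ 1 - y_u`,
`F (x + r 1_u) - F x ≥ F (y + r 1_u) - F y`. -/
def DRSubmodular {n : ℕ} (F : Vec n → ℝ) : Prop :=
  ∀ x ∈ cube n, ∀ y ∈ cube n, (∀ u, x u ≤ y u) →
    ∀ (u : Fin n) (r : ℝ), 0 ≤ r → r ≤ 1 - y u →
      F (y + EuclideanSpace.single u r) - F y ≤ F (x + EuclideanSpace.single u r) - F x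

/-- `F` is a non-negative differentiable function on the cube whose gradient on the cube is `G`.
The values of `F` and `G` outside the cube are irrelevant. -/
def NonnegWithGradient {n : ℕ} (F : Vec n → ℝ) (G : Vec n → Vec n) : Prop :=
  ∀ x ∈ cube n, 0 ≤ F x ∧ HasGradientWithinAt F (G x) (cube n) x

/-- `L`-smoothness of a function with gradient `G` on the cube. -/
def Smooth {n : ℕ} (L : ℝ) (G : Vec n → Vec n) : Prop :=
  0 ≤ L ∧ ∀ x ∈ cube n, ∀ y ∈ cube n, ‖G x - G y‖ ≤ L * ‖x - y‖

/-! ### Feasible regions -/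

/-- A down-closed convex body inside the cube. -/
structure DownClosedBody {n : ℕ} (P : Set (Vec n)) : Prop where
  subset_cube : P ⊆ cube n
  nonempty : P.Nonempty
  convex : Convex ℝ P
  compact : IsCompact P
  down_closed : ∀ y ∈ P, ∀ x : Vec n, (∀ u, 0 ≤ x u ∧ x u ≤ y u) → x ∈ P

/-- `P` has diameter (at most) `D`. -/
def HasDiameter {n : ℕ} (P : Set (Vec n)) (D : ℝ) : Prop :=
  ∀ x ∈ P, ∀ y ∈ P, ‖x - y‖ ≤ D

/-- The solution set of a finite list of explicit linear constraints `⟪a, x⟫ ≤ b`. -/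
def polyhedron {n : ℕ} (cs : List (Vec n × ℝ)) : Set (Vec n) :=
  {x | ∀ ab ∈ cs, inner ℝ ab.1 x ≤ ab.2}

/-- `lin` optimizes linear functions over the intersection of `P` with any explicitly given
polyhedron: it reports that the intersection is empty (`none`), or returns a maximizer in it. -/
def MetaSolves {n : ℕ} (P : Set (Vec n)) (lin : List (Vec n × ℝ) → Vec n → Option (Vec n)) :
    Prop :=
  ∀ (cs : List (Vec n × ℝ)) (w : Vec n),
    (lin cs w = none → P ∩ polyhedron cs = ∅) ∧
    ∀ x, lin cs w = some x →
      x ∈ P ∩ polyhedron cs ∧ ∀ y ∈ P ∩ polyhedron cs, inner ℝ w y ≤ inner ℝ w x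

/-! ### The machine model: a real RAM with oracles

Programs are finite objects that do not depend on the input. The memory consists of registers for
natural numbers and of arrays of reals. Arithmetic operations, comparisons and memory accesses
cost one step each. The input functions are only available through oracle calls. -/

/-- Expressions over the natural number registers. -/
inductive NExpr : Type
  | lit (k : ℕ)
  | reg (v : ℕ)
  | add (e₁ e₂ : NExpr)
  | sub (e₁ e₂ : NExpr)

/-- Real expressions; `get a e` is entry `e` of array `a`. -/
inductive RExpr : Type
  | cast (e : NExpr)
  | get (a : ℕ) (e : NExpr)
  | add (e₁ e₂ : RExpr)
  | sub (e₁ e₂ : RExpr)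
  | mul (e₁ e₂ : RExpr)
  | div (e₁ e₂ : RExpr)

/-- Tests. -/
inductive BExpr : Type
  | nle (e₁ e₂ : NExpr)
  | rle (e₁ e₂ : RExpr)
  | not (b : BExpr)
  | and (b₁ b₂ : BExpr)

/-- Programs. -/
inductive Cmd : Type
  | nop
  /-- register `v` := `e` -/
  | nset (v : ℕ) (e : NExpr)
  /-- entry `i` of array `a` := `e` -/
  | rset (a : ℕ) (i : NExpr) (e : RExpr)
  | seq (c₁ c₂ : Cmd)
  | ite (b : BExpr) (c₁ c₂ : Cmd)
  | loop (b : BExpr) (c : Cmd)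
  /-- write `F x` to entry `i` of array `a`, where `x` is the vector in array `src` -/
  | callVal (src a : ℕ) (i : NExpr)
  /-- write `∇F x` to array `a`, where `x` is the vector in array `src` -/
  | callGrad (src a : ℕ)
  /-- Maximize the linear function in array `w` over `P` subject to `k` linear constraints, the
  `j`-th of which has its coefficients in the `j`-th block of `n` entries of array `A` and its
  right hand side in entry `j` of array `B`. If feasible, write a maximizer to array `a` and set
  register `flag` to `1`; otherwise set it to `0`. -/
  | callLin (w A B : ℕ) (k : NExpr) (a flag : ℕ)
  /-- append the vector in array `src` to the output -/
  | emit (src : ℕ)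

/-- Memory contents, for instances of dimension `n`, and the output written so far. -/
structure State (n : ℕ) : Type where
  reg : ℕ → ℕ
  arr : ℕ → ℕ → ℝ
  out : List (Vec n)

/-- The oracles: evaluation of `F`, evaluation of `∇F`, linear optimization over `P` with
additional linear constraints. -/
structure Oracles (n : ℕ) : Type where
  val : Vec n → ℝ
  grad : Vec n → Vec n
  lin : List (Vec n × ℝ) → Vec n → Option (Vec n)

namespace State

variable {n : ℕ}

/-- The vector in array `a` (its first `n` entries). -/
def vec (s : State n) (a : ℕ) : Vec n := WithLp.toLp 2 fun u => s.arr a u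

def setReg (s : State n) (v k : ℕ) : State n :=
  { s with reg := Function.update s.reg v k }

def setEntry (s : State n) (a i : ℕ) (r : ℝ) : State n :=
  { s with arr := Function.update s.arr a (Function.update (s.arr a) i r) }

def setVec (s : State n) (a : ℕ) (x : Vec n) : State n :=
  { s with arr := Function.update s.arr a fun j => if h : j < n then x ⟨j, h⟩ else s.arr a j }

/-- The `k` linear constraints stored in the arrays `A` and `B`. -/
def constraints (s : State n) (A B k : ℕ) : List (Vec n × ℝ) :=
  (List.range k).map fun j => (WithLp.toLp 2 fun u : Fin n => s.arr A (j * n + u), s.arr B j)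

end State

def NExpr.eval {n : ℕ} (s : State n) : NExpr → ℕ
  | .lit k => k
  | .reg v => s.reg v
  | .add e₁ e₂ => e₁.eval s + e₂.eval s
  | .sub e₁ e₂ => e₁.eval s - e₂.eval s

def NExpr.cost : NExpr → ℕ
  | .lit _ => 1
  | .reg _ => 1
  | .add e₁ e₂ => e₁.cost + e₂.cost + 1
  | .sub e₁ e₂ => e₁.cost + e₂.cost + 1

noncomputable def RExpr.eval {n : ℕ} (s : State n) : RExpr → ℝ
  | .cast e => (e.eval s : ℝ)
  | .get a e => s.arr a (e.eval s)
  | .add e₁ e₂ => e₁.eval s + e₂.eval s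
  | .sub e₁ e₂ => e₁.eval s - e₂.eval s
  | .mul e₁ e₂ => e₁.eval s * e₂.eval s
  | .div e₁ e₂ => e₁.eval s / e₂.eval s

def RExpr.cost : RExpr → ℕ
  | .cast e => e.cost + 1
  | .get _ e => e.cost + 1
  | .add e₁ e₂ => e₁.cost + e₂.cost + 1
  | .sub e₁ e₂ => e₁.cost + e₂.cost + 1
  | .mul e₁ e₂ => e₁.cost + e₂.cost + 1
  | .div e₁ e₂ => e₁.cost + e₂.cost + 1

def BExpr.holds {n : ℕ} (s : State n) : BExpr → Prop
  | .nle e₁ e₂ => e₁.eval s ≤ e₂.eval s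
  | .rle e₁ e₂ => e₁.eval s ≤ e₂.eval s
  | .not b => ¬ b.holds s
  | .and b₁ b₂ => b₁.holds s ∧ b₂.holds s

def BExpr.cost : BExpr → ℕ
  | .nle e₁ e₂ => e₁.cost + e₂.cost + 1
  | .rle e₁ e₂ => e₁.cost + e₂.cost + 1
  | .not b => b.cost + 1
  | .and b₁ b₂ => b₁.cost + b₂.cost + 1

/-- `Exec O d c s s' t`: started in state `s`, program `c` halts in state `s'` after `t` steps,
where an oracle call in dimension `n` with `k` linear constraints is charged `(n + k + 2) ^ d`
steps (`k = 0` for the evaluation of `F` and `∇F`). As `d` varies, these expressions dominate all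
polynomials in `n` and `k`. -/
inductive Exec {n : ℕ} (O : Oracles n) (d : ℕ) : Cmd → State n → State n → ℕ → Prop
  | nop (s : State n) : Exec O d .nop s s 1
  | nset (s : State n) (v : ℕ) (e : NExpr) :
      Exec O d (.nset v e) s (s.setReg v (e.eval s)) (e.cost + 1)
  | rset (s : State n) (a : ℕ) (i : NExpr) (e : RExpr) :
      Exec O d (.rset a i e) s (s.setEntry a (i.eval s) (e.eval s)) (i.cost + e.cost + 1)
  | seq {c₁ c₂ : Cmd} {s₁ s₂ s₃ : State n} {t₁ t₂ : ℕ} :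
      Exec O d c₁ s₁ s₂ t₁ → Exec O d c₂ s₂ s₃ t₂ → Exec O d (.seq c₁ c₂) s₁ s₃ (t₁ + t₂)
  | ite_true {b : BExpr} {c₁ c₂ : Cmd} {s s' : State n} {t : ℕ} :
      b.holds s → Exec O d c₁ s s' t → Exec O d (.ite b c₁ c₂) s s' (b.cost + t + 1)
  | ite_false {b : BExpr} {c₁ c₂ : Cmd} {s s' : State n} {t : ℕ} :
      ¬ b.holds s → Exec O d c₂ s s' t → Exec O d (.ite b c₁ c₂) s s' (b.cost + t + 1)
  | loop_done {b : BExpr} {c : Cmd} {s : State n} :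
      ¬ b.holds s → Exec O d (.loop b c) s s (b.cost + 1)
  | loop_step {b : BExpr} {c : Cmd} {s₁ s₂ s₃ : State n} {t₁ t₂ : ℕ} :
      b.holds s₁ → Exec O d c s₁ s₂ t₁ → Exec O d (.loop b c) s₂ s₃ t₂ →
        Exec O d (.loop b c) s₁ s₃ (b.cost + t₁ + t₂ + 1)
  | callVal (s : State n) (src a : ℕ) (i : NExpr) :
      Exec O d (.callVal src a i) s (s.setEntry a (i.eval s) (O.val (s.vec src)))
        (i.cost + (n + 2) ^ d + 1)
  | callGrad (s : State n) (src a : ℕ) :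
      Exec O d (.callGrad src a) s (s.setVec a (O.grad (s.vec src))) (n + (n + 2) ^ d + 1)
  | callLin_some {s : State n} {w A B a flag : ℕ} {k : NExpr} {x : Vec n} :
      O.lin (s.constraints A B (k.eval s)) (s.vec w) = some x →
        Exec O d (.callLin w A B k a flag) s ((s.setVec a x).setReg flag 1)
          (k.cost + n + (n + k.eval s + 2) ^ d + 1)
  | callLin_none {s : State n} {w A B a flag : ℕ} {k : NExpr} :
      O.lin (s.constraints A B (k.eval s)) (s.vec w) = none →
        Exec O d (.callLin w A B k a flag) s (s.setReg flag 0)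
          (k.cost + n + (n + k.eval s + 2) ^ d + 1)
  | emit (s : State n) (src : ℕ) :
      Exec O d (.emit src) s { s with out := s.out ++ [s.vec src] } (n + 1)

/-- The initial state: register `0` holds `n`, array `0` starts with `t_s, ε, δ`, array `1` holds
`z`, everything else is zero and the output is empty. -/
noncomputable def inputState {n : ℕ} (ts ε δ : ℝ) (z : Vec n) : State n where
  reg := fun v => if v = 0 then n else 0
  arr := fun a j =>
    if a = 0 then (if j = 0 then ts else if j = 1 then ε else if j = 2 then δ else 0)
    else if a = 1 then (if h : j < n then z ⟨j, h⟩ else 0)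
    else 0
  out := []

/-! ### The two alternatives of the guarantee -/

/-- The lower bound on `F y`, with `c` in place of the constants hidden by the `O`-notation. -/
def LargeValue {n : ℕ} (c ts ε δ L D : ℝ) (F : Vec n → ℝ) (z o y : Vec n) : Prop :=
  Real.exp (-1) *
      (((2 - ts) * Real.exp ts - 1 - c * ε) * F o
        - (Real.exp ts - 1) * F (hprod z o)
        - ((2 - ts) * Real.exp ts + ts - (ts ^ 2 + 5) / 2) * F (psum z o))
    - c * (δ * D ^ 2 * L) ≤ F y

/-- `x` is an approximate local maximum with respect to `o`, and `F (x ⊕ o)` is smaller than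
`F (z ⊕ o)` by at least `ε F o`. -/
def DamagingLocalMax {n : ℕ} (c ε δ L D : ℝ) (F : Vec n → ℝ) (z o x : Vec n) : Prop :=
  F (psum x o) ≤ F (psum z o) - ε * F o ∧
    1 / 2 * (F (vmax x o) + F (vmin x o)) - c * ε * F o - c * (δ * D ^ 2 * L) ≤ F x

end FWMCG

/-!
The algorithm works in two phases of total time `1`, each split into `m` equal steps, where `1 / m`
is at most `δ` and `ε`. All smoothness errors add up to `O(D² L / m)`.

*First phase* (time `t_s`): a measured greedy algorithm guided by `z`, which moves `y` in a
direction `(1 - z - y) ⊙ v` with `v ∈ P` maximizing the linearization of `F`. Then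
`y ≤ (1 - e^{-t}) (1 - z)` at time `t`, which keeps `F (y ⊕ o) ≥ F o - (1 - e^{-t}) F (z ⊕ o)`
(`DRSubmodular.psum_ge_sub`), and the part `z ⊙ o` missing from the direction costs at most
`F (z ⊙ o)` (`GreedyInv.step`).

*Second phase* (time `1 - t_s`): `y` moves in a direction `(1 - y) ⊙ x`, where `x ∈ P` satisfies the
linear constraint that its first order gain is at least `target - F y`. Here `target` is a lower
bound on `F (y ⊕ o)`. By concavity `o` satisfies this constraint (`HybridValue.le_inner`), so
Frank–Wolfe finds an approximate local maximum `x` with respect to `o` in the constrained region.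
Either `F (x ⊕ o) ≤ F (z ⊕ o) - ε F o`, and `x` is the damaging local maximum of the second
alternative, or `F (x ⊕ o)` is so large that the step to `y + η (1 - y) ⊙ x` increases the target by
the amount that yields the additional `(1 - t_s)² / 2 · F (z ⊕ o)` (`HybridValue.step`). Integrating
the bounds of both phases gives the first alternative (`large_value_arith`).

The target depends on `o` only through its initial value `a ≈ F (y ⊕ o)` and its initial rate
`b ≈ e^{-t_s} F (z ⊕ o)`. Both are at most `2 F o`, so it suffices to try `O(1 / ε)` guesses for
each of them, as multiples of `ε v₀`, where `v₀` is a constant factor approximation of `F o`. It is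
obtained by the first phase with `0` in place of `z` (`GreedyInv.quarter_le`), unless
`F o = O(δ D² L)`, in which case the first alternative is void (`large_value_of_small`).

The program is verified with a Hoare-style predicate `Runs` that carries a time bound, and a
syntactic frame property (`Exec.frame`) that tells which variables a command leaves unchanged.
-/

namespace FWMCG

variable {n : ℕ}

/-! ### Vector operations and DR-submodular functions on the cube -/

@[simp] theorem hprod_apply (a b : Vec n) (u : Fin n) : hprod a b u = a u * b u := rfl

@[simp] theorem psum_apply (a b : Vec n) (u : Fin n) :
    psum a b u = 1 - (1 - a u) * (1 - b u) := rfl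

@[simp] theorem vmax_apply (a b : Vec n) (u : Fin n) : vmax a b u = max (a u) (b u) := rfl

@[simp] theorem vmin_apply (a b : Vec n) (u : Fin n) : vmin a b u = min (a u) (b u) := rfl

theorem zero_mem_cube : (0 : Vec n) ∈ cube n := fun u => by simp

theorem hprod_mem_cube {a b : Vec n} (ha : a ∈ cube n) (hb : b ∈ cube n) :
    hprod a b ∈ cube n := fun u =>
  ⟨mul_nonneg (ha u).1 (hb u).1, mul_le_one₀ (ha u).2 (hb u).1 (hb u).2⟩

theorem psum_mem_cube {a b : Vec n} (ha : a ∈ cube n) (hb : b ∈ cube n) :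
    psum a b ∈ cube n := fun u => by
  have h1 := ha u
  have h2 := hb u
  rw [psum_apply]
  constructor <;> nlinarith

theorem add_smul_mem_cube {x h : Vec n} (hx : x ∈ cube n) (hxh : x + h ∈ cube n) {r : ℝ}
    (h0 : 0 ≤ r) (h1 : r ≤ 1) : x + r • h ∈ cube n := fun u => by
  have h2 := hx u
  have h3 := hxh u
  simp only [PiLp.add_apply, PiLp.smul_apply, smul_eq_mul] at h3 ⊢
  constructor <;> nlinarith

theorem norm_le_of_coords_le {x y : Vec n} (h0 : ∀ u, 0 ≤ x u) (h1 : ∀ u, x u ≤ y u) :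
    ‖x‖ ≤ ‖y‖ := by
  rw [EuclideanSpace.norm_eq, EuclideanSpace.norm_eq]
  refine Real.sqrt_le_sqrt (Finset.sum_le_sum fun u _ => ?_)
  rw [Real.norm_of_nonneg (h0 u), Real.norm_of_nonneg ((h0 u).trans (h1 u))]
  exact pow_le_pow_left₀ (h0 u) (h1 u) 2

/-- Diminishing returns along an arbitrary non-negative direction, obtained by moving one
coordinate at a time. -/
theorem DRSubmodular.vector {F : Vec n → ℝ} (hF : DRSubmodular F) {x y h : Vec n}
    (hx : x ∈ cube n) (hxy : ∀ u, x u ≤ y u) (hh : ∀ u, 0 ≤ h u) (hy : y + h ∈ cube n) :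
    F (y + h) - F y ≤ F (x + h) - F x := by
  classical
  let part : Finset (Fin n) → Vec n := fun s => WithLp.toLp 2 fun u => if u ∈ s then h u else 0
  have hp : ∀ s u, part s u = if u ∈ s then h u else 0 := fun _ _ => rfl
  have key : ∀ s : Finset (Fin n),
      F (y + part s) - F y ≤ F (x + part s) - F x := by
    intro s
    induction s using Finset.induction_on with
    | empty =>
      have h0 : part ∅ = 0 := by ext u; simp [hp]
      simp [h0]
    | insert v s hv ih =>
      have hins : part (insert v s) = part s + EuclideanSpace.single v (h v) := by
        ext u
        by_cases huv : u = v
        · subst huv; simp [hp, hv]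
        · simp [hp, huv]
      have hpb : ∀ u, 0 ≤ part s u ∧ part s u ≤ h u := by
        intro u
        rw [hp]
        split_ifs
        · exact ⟨hh u, le_rfl⟩
        · exact ⟨le_rfl, hh u⟩
      have hyc : ∀ u, 0 ≤ y u + h u ∧ y u + h u ≤ 1 := fun u => by simpa using hy u
      have := hF (x + part s) (fun u => by
          have := hpb u; have := hx u; have := hxy u; have := hyc u
          simp only [PiLp.add_apply]; constructor <;> linarith)
        (y + part s) (fun u => by
          have := hpb u; have := hx u; have := hxy u; have := hyc u
          simp only [PiLp.add_apply]; constructor <;> linarith)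
        (fun u => by simpa using hxy u) v (h v) (hh v) (by
          have := hyc v
          simp only [PiLp.add_apply, hp, hv, if_false]; linarith)
      rw [hins, ← add_assoc, ← add_assoc]
      linarith
  have hu : part Finset.univ = h := by ext u; simp [hp]
  simpa [hu] using key Finset.univ

/-- The derivative of `F` along a segment of the cube, in terms of the gradient. -/
theorem NonnegWithGradient.hasDerivWithinAt {F : Vec n → ℝ} {G : Vec n → Vec n}
    (hF : NonnegWithGradient F G) {x h : Vec n} (hx : x ∈ cube n) (hxh : x + h ∈ cube n) {t : ℝ}
    (ht : t ∈ Set.Icc (0 : ℝ) 1) :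
    HasDerivWithinAt (fun r : ℝ => F (x + r • h)) (inner ℝ (G (x + t • h)) h)
      (Set.Icc 0 1) t := by
  have h1 := (hF _ (add_smul_mem_cube hx hxh ht.1 ht.2)).2.hasFDerivWithinAt
  have h2 : HasDerivWithinAt (fun r : ℝ => x + r • h) h (Set.Icc 0 1) t := by
    simpa using ((hasDerivWithinAt_id t (Set.Icc 0 1)).smul_const h).const_add x
  have h3 := h1.comp_hasDerivWithinAt t h2
    (fun r hr => add_smul_mem_cube hx hxh hr.1 hr.2)
  rw [InnerProductSpace.toDual_apply_apply] at h3
  exact h3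

/-- DR-submodular functions are concave along non-negative directions. -/
theorem DRSubmodular.concave {F : Vec n → ℝ} {G : Vec n → Vec n} (hF : DRSubmodular F)
    (hG : NonnegWithGradient F G) {x h : Vec n}
    (hx : x ∈ cube n) (hh : ∀ u, 0 ≤ h u) (hxh : x + h ∈ cube n) :
    ConcaveOn ℝ (Set.Icc (0 : ℝ) 1) fun r => F (x + r • h) := by
  have hd := fun t (ht : t ∈ Set.Icc (0 : ℝ) 1) => hG.hasDerivWithinAt hx hxh ht
  have hd' : ∀ t ∈ Set.Ioo (0 : ℝ) 1, HasDerivAt (fun r : ℝ => F (x + r • h))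
      (inner ℝ (G (x + t • h)) h) t := fun t ht =>
    (hd t ⟨ht.1.le, ht.2.le⟩).hasDerivAt (Icc_mem_nhds ht.1 ht.2)
  refine AntitoneOn.concaveOn_of_deriv (convex_Icc 0 1)
    (fun t ht => (hd t ht).continuousWithinAt) ?_ ?_
  · rw [interior_Icc]
    exact fun t ht => (hd' t ht).differentiableAt.differentiableWithinAt
  · rw [interior_Icc]
    intro s hs t ht hst
    rw [(hd' s hs).deriv, (hd' t ht).deriv]
    have ls := ((hasDerivAt_iff_tendsto_slope_zero.1 (hd' s hs)).mono_left
      (nhdsGT_le_nhdsNE 0))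
    have lt := ((hasDerivAt_iff_tendsto_slope_zero.1 (hd' t ht)).mono_left
      (nhdsGT_le_nhdsNE 0))
    refine le_of_tendsto_of_tendsto lt ls ?_
    filter_upwards [Ioo_mem_nhdsGT (sub_pos.2 ht.2)] with r hr
    have := hF.vector (x := x + s • h) (y := x + t • h) (h := r • h)
      (add_smul_mem_cube hx hxh hs.1.le hs.2.le)
      (fun u => by
        simpa using mul_le_mul_of_nonneg_right hst (hh u))
      (fun u => by simpa using mul_nonneg hr.1.le (hh u))
      (by
        rw [add_assoc, ← add_smul]
        exact add_smul_mem_cube hx hxh (by linarith [hr.1, ht.1]) (by linarith [hr.2]))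
    rw [add_assoc, ← add_smul, add_assoc, ← add_smul] at this
    simp only [smul_eq_mul]
    exact mul_le_mul_of_nonneg_left this (inv_nonneg.2 hr.1.le)

/-- A function that lies above its chord from `x` to `x + h` has at least the slope of the chord
at `x`. -/
theorem NonnegWithGradient.chord_le_inner {F : Vec n → ℝ} {G : Vec n → Vec n}
    (hG : NonnegWithGradient F G) {x h : Vec n} (hx : x ∈ cube n) (hxh : x + h ∈ cube n)
    (hc : ∀ r ∈ Set.Icc (0 : ℝ) 1, (1 - r) * F x + r * F (x + h) ≤ F (x + r • h)) :
    F (x + h) - F x ≤ inner ℝ (G x) h := by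
  have hd := hG.hasDerivWithinAt hx hxh (t := 0) (by simp)
  rw [hasDerivWithinAt_iff_tendsto_slope] at hd
  have hd' := hd.mono_left (nhdsWithin_mono (0 : ℝ)
    (show Set.Ioo (0 : ℝ) 1 ⊆ Set.Icc 0 1 \ {0} from
      fun t ht => ⟨⟨ht.1.le, ht.2.le⟩, ht.1.ne'⟩))
  rw [zero_smul, add_zero] at hd'
  have hne : (nhdsWithin (0 : ℝ) (Set.Ioo 0 1)).NeBot := by
    rw [nhdsWithin_Ioo_eq_nhdsGT one_pos]; infer_instance
  refine ge_of_tendsto hd' ?_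
  filter_upwards [self_mem_nhdsWithin] with r hr
  have := hc r ⟨hr.1.le, hr.2.le⟩
  rw [slope_def_field, sub_zero, zero_smul, add_zero, le_div_iff₀ hr.1]
  linarith

/-- `F` lies above its chords along non-negative directions; the form in which concavity is
used. -/
theorem DRSubmodular.above_chord {F : Vec n → ℝ} {G : Vec n → Vec n} (hF : DRSubmodular F)
    (hG : NonnegWithGradient F G) {x h : Vec n}
    (hx : x ∈ cube n) (hh : ∀ u, 0 ≤ h u) (hxh : x + h ∈ cube n) {r : ℝ}
    (h0 : 0 ≤ r) (h1 : r ≤ 1) : (1 - r) * F x + r * F (x + h) ≤ F (x + r • h) := by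
  have := (hF.concave hG hx hh hxh).2 (x := 0) (y := 1) (by simp) (by simp)
    (sub_nonneg.2 h1) h0 (by ring)
  simpa using this

/-- The first order bound for moving upwards. -/
theorem DRSubmodular.sub_le_inner {F : Vec n → ℝ} {G : Vec n → Vec n} (hF : DRSubmodular F)
    (hG : NonnegWithGradient F G) {x h : Vec n}
    (hx : x ∈ cube n) (hh : ∀ u, 0 ≤ h u) (hxh : x + h ∈ cube n) :
    F (x + h) - F x ≤ inner ℝ (G x) h :=
  hG.chord_le_inner hx hxh fun _ hr => hF.above_chord hG hx hh hxh hr.1 hr.2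

/-- The first order bound for moving downwards. -/
theorem DRSubmodular.inner_le_sub {F : Vec n → ℝ} {G : Vec n → Vec n} (hF : DRSubmodular F)
    (hG : NonnegWithGradient F G) {x h : Vec n}
    (hx : x ∈ cube n) (hh : ∀ u, 0 ≤ h u) (hxh : x - h ∈ cube n) :
    inner ℝ (G x) h ≤ F x - F (x - h) := by
  have := hG.chord_le_inner hx (h := -h) (by simpa [sub_eq_add_neg] using hxh) (by
    intro r hr
    have := hF.above_chord hG hxh hh (by simpa using hx) (sub_nonneg.2 hr.2)
      (sub_le_self 1 hr.1)
    have e : x - h + (1 - r) • h = x + r • -h := by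
      rw [sub_smul, one_smul, smul_neg]; abel
    rw [e, sub_add_cancel] at this
    rw [← sub_eq_add_neg]
    linarith)
  rw [inner_neg_right, ← sub_eq_add_neg] at this
  linarith

/-- The local optimality inequality behind Frank–Wolfe for DR-submodular functions. -/
theorem DRSubmodular.vmax_add_vmin_le {F : Vec n → ℝ} {G : Vec n → Vec n} (hF : DRSubmodular F)
    (hG : NonnegWithGradient F G) {x o : Vec n} (hx : x ∈ cube n) (ho : o ∈ cube n) :
    F (vmax x o) + F (vmin x o) - 2 * F x ≤ inner ℝ (G x) (o - x) := by
  have e1 : vmax x o = x + (vmax x o - x) := by abel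
  have e2 : vmin x o = x - (x - vmin x o) := by abel
  have hmax : vmax x o ∈ cube n := fun u =>
    ⟨(hx u).1.trans (le_max_left _ _), max_le (hx u).2 (ho u).2⟩
  have hmin : vmin x o ∈ cube n := fun u =>
    ⟨le_min (hx u).1 (ho u).1, (min_le_left _ _).trans (hx u).2⟩
  have h1 := hF.sub_le_inner hG hx (h := vmax x o - x) (fun u => by simp) (by rwa [← e1])
  have h2 := hF.inner_le_sub hG hx (h := x - vmin x o) (fun u => by simp) (by rwa [← e2])
  rw [← e1] at h1
  rw [← e2] at h2
  have e3 : o - x = (vmax x o - x) - (x - vmin x o) := by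
    ext u
    simp only [PiLp.sub_apply, vmax_apply, vmin_apply]
    linarith [max_add_min (x u) (o u)]
  rw [e3, inner_sub_right]
  linarith

/-- The descent lemma, with constant `L` in place of the usual `L / 2`; the mean value theorem is
enough for it. -/
theorem Smooth.lower_bound {F : Vec n → ℝ} {G : Vec n → Vec n} {L : ℝ} (hL : Smooth L G)
    (hG : NonnegWithGradient F G) {x h : Vec n} (hx : x ∈ cube n) (hxh : x + h ∈ cube n) :
    F x + inner ℝ (G x) h - L * ‖h‖ ^ 2 ≤ F (x + h) := by
  have hd := fun t (ht : t ∈ Set.Icc (0 : ℝ) 1) => hG.hasDerivWithinAt hx hxh ht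
  obtain ⟨t, ht, he⟩ := exists_hasDerivAt_eq_slope (fun r : ℝ => F (x + r • h))
    (fun t => inner ℝ (G (x + t • h)) h) one_pos (fun t ht => (hd t ht).continuousWithinAt)
    (fun t ht => (hd t ⟨ht.1.le, ht.2.le⟩).hasDerivAt (Icc_mem_nhds ht.1 ht.2))
  simp only [one_smul, zero_smul, add_zero, sub_zero, div_one] at he
  have h1 : inner ℝ (G x) h - inner ℝ (G (x + t • h)) h ≤ L * ‖h‖ ^ 2 := by
    rw [← inner_sub_left]
    calc inner ℝ (G x - G (x + t • h)) h ≤ ‖G x - G (x + t • h)‖ * ‖h‖ := real_inner_le_norm _ _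
      _ ≤ (L * ‖x - (x + t • h)‖) * ‖h‖ := by
        gcongr
        exact hL.2 _ hx _ (add_smul_mem_cube hx hxh ht.1.le ht.2.le)
      _ = (L * ‖h‖ ^ 2) * t := by
        rw [sub_add_cancel_left, norm_neg, norm_smul, Real.norm_of_nonneg ht.1.le]; ring
      _ ≤ L * ‖h‖ ^ 2 := mul_le_of_le_one_right (mul_nonneg hL.1 (sq_nonneg _)) ht.2.le
  linarith

/-- If no coordinate of `y` exceeds `θ`, then adding `y` costs at most a `θ` fraction of the
value. -/
theorem DRSubmodular.psum_ge_of_le {F : Vec n → ℝ} {G : Vec n → Vec n} (hF : DRSubmodular F)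
    (hG : NonnegWithGradient F G) {p y : Vec n} {θ : ℝ} (hp : p ∈ cube n) (h0 : ∀ u, 0 ≤ y u)
    (hy : ∀ u, y u ≤ θ) (hθ0 : 0 ≤ θ) (hθ : θ ≤ 1) : (1 - θ) * F p ≤ F (psum y p) := by
  rcases hθ0.eq_or_lt with rfl | hθ'
  · have : psum y p = p := by
      ext u
      have : y u = 0 := le_antisymm (hy u) (h0 u)
      simp [this]
    simp [this]
  · let h : Vec n := WithLp.toLp 2 fun u => (1 - p u) * (y u / θ)
    have hh : ∀ u, h u = (1 - p u) * (y u / θ) := fun _ => rfl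
    have hv : ∀ u, 0 ≤ y u / θ ∧ y u / θ ≤ 1 := fun u =>
      ⟨div_nonneg (h0 u) hθ0, (div_le_one hθ').2 (hy u)⟩
    have hpc : p + h ∈ cube n := fun u => by
      have := hv u; have := hp u
      simp only [PiLp.add_apply, hh]
      constructor <;> nlinarith
    have := hF.above_chord hG hp (h := h)
      (fun u => mul_nonneg (by linarith [(hp u).2]) (hv u).1) hpc hθ0 hθ
    have e : p + θ • h = psum y p := by
      ext u
      simp only [PiLp.add_apply, PiLp.smul_apply, smul_eq_mul, hh, psum_apply]
      field_simp
      ring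
    rw [e] at this
    nlinarith [(hG _ hpc).1]

/-- Adding a vector below `θ (1 - z)` to `o` costs at most `θ F (z ⊕ o)`. -/
theorem DRSubmodular.psum_ge_sub {F : Vec n → ℝ} {G : Vec n → Vec n} (hF : DRSubmodular F)
    (hG : NonnegWithGradient F G) {o y z : Vec n} {θ : ℝ} (ho : o ∈ cube n) (hz : z ∈ cube n)
    (h0 : ∀ u, 0 ≤ y u) (hy : ∀ u, y u ≤ θ * (1 - z u)) (hθ0 : 0 ≤ θ) (hθ : θ ≤ 1) :
    F o - θ * F (psum z o) ≤ F (psum y o) := by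
  rcases hθ0.eq_or_lt with rfl | hθ'
  · have : psum y o = o := by
      ext u
      have : y u = 0 := le_antisymm (by simpa using hy u) (h0 u)
      simp [this]
    simp [this]
  · let h : Vec n := WithLp.toLp 2 fun u => (1 - o u) * (y u / θ)
    have hh : ∀ u, h u = (1 - o u) * (y u / θ) := fun _ => rfl
    let k : Vec n := WithLp.toLp 2 fun u => (1 - o u) * z u
    have hk : ∀ u, k u = (1 - o u) * z u := fun _ => rfl
    have hv : ∀ u, 0 ≤ y u / θ ∧ y u / θ ≤ 1 - z u := fun u =>
      ⟨div_nonneg (h0 u) hθ0, (div_le_iff₀' hθ').2 (hy u)⟩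
    have hoc : o + h ∈ cube n := fun u => by
      have := hv u; have := ho u; have := hz u
      simp only [PiLp.add_apply, hh]
      constructor <;> nlinarith
    have hokc : o + k + h ∈ cube n := fun u => by
      have := hv u; have := ho u; have := hz u
      simp only [PiLp.add_apply, hh, hk]
      constructor <;> nlinarith
    have hh0 : ∀ u, 0 ≤ h u := fun u => mul_nonneg (by linarith [(ho u).2]) (hv u).1
    have h1 := hF.above_chord hG ho hh0 hoc hθ0 hθ
    have h2 := hF.vector ho (y := o + k) (h := h)
      (fun u => by
        have : 0 ≤ k u := mul_nonneg (by linarith [(ho u).2]) (hz u).1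
        simpa using this) hh0 hokc
    have e : o + θ • h = psum y o := by
      ext u
      simp only [PiLp.add_apply, PiLp.smul_apply, smul_eq_mul, hh, psum_apply]
      field_simp
      ring
    have e2 : o + k = psum z o := by
      ext u
      simp only [PiLp.add_apply, hk, psum_apply]
      ring
    rw [e] at h1
    rw [e2] at h2
    have h3 := (hG (psum z o + h) (by rwa [← e2])).1
    nlinarith

theorem DownClosedBody.zero_mem {P : Set (Vec n)} (hP : DownClosedBody P) : (0 : Vec n) ∈ P := by
  obtain ⟨y, hy⟩ := hP.nonempty
  exact hP.down_closed y hy 0 fun u => ⟨le_rfl, (hP.subset_cube hy u).1⟩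

theorem DownClosedBody.norm_le {P : Set (Vec n)} (hP : DownClosedBody P) {D : ℝ}
    (hD : HasDiameter P D) {x : Vec n} (hx : x ∈ P) : ‖x‖ ≤ D := by
  simpa using hD x hx 0 hP.zero_mem

/-- Adding a point of `P` to a maximizer of `F` over `P` at most doubles the value. -/
theorem DRSubmodular.psum_le_two_mul {F : Vec n → ℝ} {G : Vec n → Vec n} (hF : DRSubmodular F)
    (hG : NonnegWithGradient F G) {P : Set (Vec n)} (hP : DownClosedBody P) {o y : Vec n}
    (ho : o ∈ P) (hmax : ∀ x ∈ P, F x ≤ F o) (hy : y ∈ P) : F (psum y o) ≤ 2 * F o := by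
  have hoc := hP.subset_cube ho
  have hyc := hP.subset_cube hy
  let k : Vec n := WithLp.toLp 2 fun u => (1 - o u) * y u
  have hk : ∀ u, k u = (1 - o u) * y u := fun _ => rfl
  have hk0 : ∀ u, 0 ≤ k u := fun u => mul_nonneg (by linarith [(hoc u).2]) (hyc u).1
  have hkP : k ∈ P := hP.down_closed y hy k fun u =>
    ⟨hk0 u, mul_le_of_le_one_left (hyc u).1 (by linarith [(hoc u).1])⟩
  have e : o + k = psum y o := by
    ext u
    simp only [PiLp.add_apply, hk, psum_apply]
    ring
  have := hF.vector zero_mem_cube (y := o) (h := k) (fun u => (hoc u).1) hk0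
    (by rw [e]; exact psum_mem_cube hyc hoc)
  rw [e, zero_add] at this
  linarith [hmax k hkP, (hG 0 zero_mem_cube).1]

/-! ### The guided measured greedy phase -/

/-- `y` lies below `s` times a point of `P`. -/
def ScaledMem (P : Set (Vec n)) (s : ℝ) (y : Vec n) : Prop := ∃ p ∈ P, ∀ u, y u ≤ s * p u

theorem ScaledMem.mem {P : Set (Vec n)} (hP : DownClosedBody P) {s : ℝ} {y : Vec n}
    (hs : s ≤ 1) (h0 : ∀ u, 0 ≤ y u) (hy : ScaledMem P s y) : y ∈ P := by
  obtain ⟨p, hp, h⟩ := hy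
  exact hP.down_closed p hp y fun u =>
    ⟨h0 u, (h u).trans (mul_le_of_le_one_left (hP.subset_cube hp u).1 hs)⟩

theorem ScaledMem.add {P : Set (Vec n)} (hP : DownClosedBody P) {s η : ℝ} {y v d : Vec n}
    (hs : 0 ≤ s) (hη : 0 < η) (hy : ScaledMem P s y) (hv : v ∈ P) (hd : ∀ u, d u ≤ v u) :
    ScaledMem P (s + η) (y + η • d) := by
  obtain ⟨p, hp, h⟩ := hy
  have hsη : 0 < s + η := by linarith
  refine ⟨(s / (s + η)) • p + (η / (s + η)) • v,
    hP.convex hp hv (by positivity) (by positivity) (by field_simp), fun u => ?_⟩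
  have := h u
  have := mul_le_mul_of_nonneg_left (hd u) hη.le
  simp only [PiLp.add_apply, PiLp.smul_apply, smul_eq_mul]
  have e : (s + η) * (s / (s + η) * p u + η / (s + η) * v u) = s * p u + η * v u := by
    field_simp
  linarith

theorem inner_hprod_left (a b c : Vec n) : inner ℝ (hprod a b) c = inner ℝ b (hprod a c) := by
  simp only [PiLp.inner_apply, hprod_apply, RCLike.inner_apply, conj_trivial]
  exact Finset.sum_congr rfl fun u _ => by ring

/-- The vector `1 - z - y`: the room left by `y` below `1 - z`. -/
def slack (z y : Vec n) : Vec n := WithLp.toLp 2 fun u => 1 - z u - y u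

@[simp] theorem slack_apply (z y : Vec n) (u : Fin n) : slack z y u = 1 - z u - y u := rfl

/-- What `i` greedy steps of size `η` guided by `z` have achieved: `y` stays below
`(1 - (1 - η) ^ i) (1 - z)`, and its value follows the discretized differential inequality
`F' ≥ F o - (F (z ⊙ o) - F 0) - (1 - (1 - η) ^ i) F (z ⊕ o) - F`. -/
structure GreedyInv (F : Vec n → ℝ) (P : Set (Vec n)) (S : ℝ) (z : Vec n) (η : ℝ) (i : ℕ)
    (y : Vec n) : Prop where
  nonneg : ∀ u, 0 ≤ y u
  le : ∀ u, y u ≤ (1 - (1 - η) ^ i) * (1 - z u)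
  scaled : ScaledMem P (i * η) y
  value : ∀ o ∈ P, (1 - (1 - η) ^ i) * (F o - (F (hprod z o) - F 0) - F (psum z o))
    + i * η * ((1 - η) ^ i / (1 - η)) * F (psum z o) - i * η ^ 2 * S ≤ F y

theorem GreedyInv.zero {F : Vec n → ℝ} {G : Vec n → Vec n} (hG : NonnegWithGradient F G)
    {P : Set (Vec n)} (hP : DownClosedBody P) (S : ℝ) (z : Vec n) (η : ℝ) :
    GreedyInv F P S z η 0 0 where
  nonneg := by simp
  le := by simp
  scaled := ⟨0, hP.zero_mem, by simp⟩
  value := by simpa using fun _ _ => (hG 0 zero_mem_cube).1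

/-- A step of size `η` in a direction `0 ≤ d ≤ v` with `v ∈ P`, which has norm at most `D`. -/
theorem smooth_step {F : Vec n → ℝ} {G : Vec n → Vec n} {L D : ℝ} {P : Set (Vec n)}
    (hG : NonnegWithGradient F G) (hL : Smooth L G) (hP : DownClosedBody P)
    (hD : HasDiameter P D) {y d v : Vec n} {η : ℝ} (hy : y ∈ cube n) (hy' : y + η • d ∈ cube n)
    (hv : v ∈ P) (hd0 : ∀ u, 0 ≤ d u) (hd : ∀ u, d u ≤ v u) :
    F y + η * inner ℝ (G y) d - η ^ 2 * (D ^ 2 * L) ≤ F (y + η • d) := by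
  have h1 := hL.lower_bound hG hy hy'
  rw [norm_smul, mul_pow, inner_smul_right, Real.norm_eq_abs, sq_abs] at h1
  have h2 : ‖d‖ ^ 2 ≤ D ^ 2 :=
    pow_le_pow_left₀ (norm_nonneg _) ((norm_le_of_coords_le hd0 hd).trans (hP.norm_le hD hv)) 2
  have h3 := mul_le_mul_of_nonneg_left h2 (mul_nonneg hL.1 (sq_nonneg η))
  linarith

theorem GreedyInv.step {F : Vec n → ℝ} {G : Vec n → Vec n} {L D : ℝ} {P : Set (Vec n)}
    (hF : DRSubmodular F) (hG : NonnegWithGradient F G) (hL : Smooth L G)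
    (hP : DownClosedBody P) (hD : HasDiameter P D) {z y v : Vec n} {η : ℝ} {i : ℕ}
    (hz : z ∈ cube n) (hη0 : 0 < η) (hη1 : η < 1) (h : GreedyInv F P (D ^ 2 * L) z η i y)
    (hv : v ∈ P)
    (hmax : ∀ x ∈ P, inner ℝ (hprod (slack z y) (G y)) x ≤ inner ℝ (hprod (slack z y) (G y)) v) :
    GreedyInv F P (D ^ 2 * L) z η (i + 1) (y + η • hprod (slack z y) v) := by
  have hr0 : 0 < 1 - η := by linarith
  have hri0 : 0 < (1 - η) ^ i := pow_pos hr0 i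
  have hri1 : (1 - η) ^ i ≤ 1 := pow_le_one₀ hr0.le (by linarith)
  have hvc := hP.subset_cube hv
  have hs : ∀ u, 0 ≤ slack z y u ∧ slack z y u ≤ 1 := fun u => by
    have := h.nonneg u
    have := h.le u
    have := hz u
    rw [slack_apply]
    constructor <;> nlinarith
  have hd0 : ∀ u, 0 ≤ hprod (slack z y) v u := fun u => mul_nonneg (hs u).1 (hvc u).1
  have hd : ∀ u, hprod (slack z y) v u ≤ v u := fun u =>
    mul_le_of_le_one_left (hvc u).1 (hs u).2
  have hnn : ∀ u, 0 ≤ (y + η • hprod (slack z y) v) u := fun u => by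
    simpa using add_nonneg (h.nonneg u) (mul_nonneg hη0.le (hd0 u))
  have hle : ∀ u, (y + η • hprod (slack z y) v) u ≤ (1 - (1 - η) ^ (i + 1)) * (1 - z u) := by
    intro u
    simp only [PiLp.add_apply, PiLp.smul_apply, smul_eq_mul, hprod_apply]
    have h1 : slack z y u * v u ≤ slack z y u :=
      mul_le_of_le_one_right (hs u).1 (hvc u).2
    have h2 := mul_le_mul_of_nonneg_left h1 hη0.le
    have h3 := mul_le_mul_of_nonneg_left (h.le u) hr0.le
    rw [slack_apply] at h2 ⊢
    rw [pow_succ]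
    linarith
  have hyc : y ∈ cube n := fun u => by
    have := h.nonneg u
    have := h.le u
    have := hz u
    constructor <;> nlinarith
  have hyc' : y + η • hprod (slack z y) v ∈ cube n := fun u => by
    have h1 := hle u
    have h2 := hz u
    have h3 : 0 < (1 - η) ^ (i + 1) := pow_pos hr0 _
    refine ⟨hnn u, h1.trans ?_⟩
    nlinarith
  refine ⟨hnn, hle, ?_, fun o ho => ?_⟩
  · have := h.scaled.add hP (by positivity) hη0 hv hd
    rwa [show ((i + 1 : ℕ) : ℝ) * η = i * η + η by push_cast; ring]
  · have hoc := hP.subset_cube ho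
    have h1 := smooth_step hG hL hP hD hyc hyc' hv hd0 hd
    have h2 := hmax o ho
    rw [inner_hprod_left, inner_hprod_left] at h2
    have hqc : y + hprod (slack z y) o ∈ cube n := fun u => by
      have := h.nonneg u
      have := hs u
      have := hoc u
      have := hz u
      simp only [PiLp.add_apply, hprod_apply, slack_apply] at *
      constructor <;> nlinarith
    have h3 := hF.sub_le_inner hG hyc (h := hprod (slack z y) o)
      (fun u => mul_nonneg (hs u).1 (hoc u).1) hqc
    have e : y + hprod (slack z y) o + hprod z o = psum y o := by
      ext u
      simp only [PiLp.add_apply, hprod_apply, slack_apply, psum_apply]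
      ring
    -- The part `z ⊙ o` missing from the step is worth at most `F (z ⊙ o)`.
    have h4 := hF.vector zero_mem_cube (y := y + hprod (slack z y) o) (h := hprod z o)
      (fun u => (hqc u).1) (fun u => (hprod_mem_cube hz hoc u).1)
      (by rw [e]; exact psum_mem_cube hyc hoc)
    rw [e, zero_add] at h4
    have h5 := hF.psum_ge_sub hG hoc hz h.nonneg h.le (by linarith) (by linarith)
    have h7 := h.value o ho
    have h8 := mul_le_mul_of_nonneg_left
      (show F o - (1 - (1 - η) ^ i) * F (psum z o) - (F (hprod z o) - F 0) - F y
        ≤ inner ℝ (G y) (hprod (slack z y) v) by linarith) hη0.le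
    have h9 := mul_le_mul_of_nonneg_left h7 hr0.le
    have hS : 0 ≤ D ^ 2 * L := mul_nonneg (sq_nonneg _) hL.1
    have h10 : 0 ≤ η * (i * η ^ 2 * (D ^ 2 * L)) := by positivity
    have h11 : (1 - (1 - η) ^ (i + 1)) * (F o - (F (hprod z o) - F 0) - F (psum z o))
        + ((i + 1 : ℕ) : ℝ) * η * ((1 - η) ^ (i + 1) / (1 - η)) * F (psum z o)
        - ((i + 1 : ℕ) : ℝ) * η ^ 2 * (D ^ 2 * L)
      = (1 - η) * ((1 - (1 - η) ^ i) * (F o - (F (hprod z o) - F 0) - F (psum z o))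
        + i * η * ((1 - η) ^ i / (1 - η)) * F (psum z o) - i * η ^ 2 * (D ^ 2 * L))
        + η * (F o - (1 - (1 - η) ^ i) * F (psum z o) - (F (hprod z o) - F 0))
        - η ^ 2 * (D ^ 2 * L) - η * (i * η ^ 2 * (D ^ 2 * L)) := by
      push_cast
      rw [pow_succ]
      field_simp
      ring
    linarith

/-! ### The second phase -/

/-- The lower bound on `F (y ⊕ o)` maintained by the second phase after `k` steps of size `η`,
starting from the lower bound `a`. -/
noncomputable def target (η a b : ℝ) (k : ℕ) : ℝ := (1 - η) ^ k * (a + k * η * b / (1 - η))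

/-- The lower bound on `F y` maintained by the second phase after `k` steps of size `η`, starting
from the value `f`; it solves the recursion `f ↦ (1 - η) f + η target - η² S`, up to the last
term. -/
noncomputable def progress (η S a b f : ℝ) (k : ℕ) : ℝ :=
  (1 - η) ^ k * (f + k * η * a / (1 - η) + η ^ 2 * (k * (k - 1) / 2) * b / (1 - η) ^ 2)
    - k * η ^ 2 * S

theorem target_succ {η : ℝ} (h : η < 1) (a b : ℝ) (k : ℕ) :
    target η a b (k + 1) = (1 - η) * target η a b k + η * ((1 - η) ^ k * b) := by
  have : 1 - η ≠ 0 := by linarith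
  rw [target, target, pow_succ]
  push_cast
  field_simp
  ring

theorem progress_succ {η : ℝ} (h0 : 0 ≤ η) (h : η < 1) {S : ℝ} (hS : 0 ≤ S) (a b f : ℝ) (k : ℕ) :
    progress η S a b f (k + 1) ≤
      (1 - η) * progress η S a b f k + η * target η a b k - η ^ 2 * S := by
  have h1 : 1 - η ≠ 0 := by linarith
  have h2 : 0 ≤ η * (k * η ^ 2 * S) := by positivity
  have e : progress η S a b f (k + 1) =
      (1 - η) * progress η S a b f k + η * target η a b k - η ^ 2 * S
        - η * (k * η ^ 2 * S) := by
    rw [progress, progress, target, pow_succ]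
    push_cast
    field_simp
    ring
  linarith

/-- The part of the second phase's invariant that does not depend on the comparison point. The
phase starts at time `τ` with a vector whose coordinates are at most `1 - ρ`. -/
structure HybridInv (P : Set (Vec n)) (τ ρ η : ℝ) (k : ℕ) (y : Vec n) : Prop where
  nonneg : ∀ u, 0 ≤ y u
  le : ∀ u, y u ≤ 1 - ρ * (1 - η) ^ k
  scaled : ScaledMem P (τ + k * η) y

/-- The part of the second phase's invariant that concerns the comparison point `o`. -/
structure HybridValue (F : Vec n → ℝ) (S η a b f : ℝ) (o : Vec n) (k : ℕ) (y : Vec n) :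
    Prop where
  target_le : target η a b k ≤ F (psum y o)
  progress_le : progress η S a b f k ≤ F y

theorem HybridInv.mem_cube {P : Set (Vec n)} {τ ρ η : ℝ} {k : ℕ} {y : Vec n}
    (h : HybridInv P τ ρ η k y) (hρ : 0 ≤ ρ) (hη1 : η < 1) : y ∈ cube n := fun u =>
  ⟨h.nonneg u, (h.le u).trans (sub_le_self _ (mul_nonneg hρ (pow_nonneg (by linarith) _)))⟩

theorem HybridInv.step {P : Set (Vec n)} (hP : DownClosedBody P) {τ ρ η : ℝ} {k : ℕ}
    {y x : Vec n} (hτ : 0 ≤ τ) (hρ : 0 ≤ ρ) (hη0 : 0 < η) (hη1 : η < 1)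
    (h : HybridInv P τ ρ η k y) (hx : x ∈ P) :
    HybridInv P τ ρ η (k + 1) (y + η • hprod (slack 0 y) x) := by
  have hxc := hP.subset_cube hx
  have hyc := h.mem_cube hρ hη1
  have hd0 : ∀ u, 0 ≤ hprod (slack 0 y) x u := fun u =>
    mul_nonneg (by simpa using (hyc u).2) (hxc u).1
  have hd : ∀ u, hprod (slack 0 y) x u ≤ x u := fun u =>
    mul_le_of_le_one_left (hxc u).1 (by simpa using (hyc u).1)
  refine ⟨fun u => ?_, fun u => ?_, ?_⟩
  · simpa using add_nonneg (h.nonneg u) (mul_nonneg hη0.le (hd0 u))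
  · have h1 : (1 - y u) * x u ≤ 1 - y u :=
      mul_le_of_le_one_right (by linarith [(hyc u).2]) (hxc u).2
    have h2 := mul_le_mul_of_nonneg_left h1 hη0.le
    have h3 := mul_le_mul_of_nonneg_left (h.le u) (show 0 ≤ 1 - η by linarith)
    simp only [PiLp.add_apply, PiLp.smul_apply, smul_eq_mul, hprod_apply, slack_apply,
      PiLp.zero_apply, sub_zero]
    rw [pow_succ]
    linarith
  · have := h.scaled.add hP (by positivity) hη0 hx hd
    rwa [show τ + ((k + 1 : ℕ) : ℝ) * η = τ + k * η + η by push_cast; ring]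

/-- The comparison point satisfies the linear constraint imposed on the directions of the second
phase. -/
theorem HybridValue.le_inner {F : Vec n → ℝ} {G : Vec n → Vec n} (hF : DRSubmodular F)
    (hG : NonnegWithGradient F G) {S η a b f : ℝ} {o y : Vec n} {k : ℕ}
    (h : HybridValue F S η a b f o k y) (hy : y ∈ cube n) (ho : o ∈ cube n) :
    target η a b k - F y ≤ inner ℝ (hprod (slack 0 y) (G y)) o := by
  have e : y + hprod (slack 0 y) o = psum y o := by
    ext u
    simp only [PiLp.add_apply, hprod_apply, slack_apply, psum_apply, PiLp.zero_apply]
    ring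
  have := hF.sub_le_inner hG hy (h := hprod (slack 0 y) o)
    (fun u => mul_nonneg (by simpa using (hy u).2) (ho u).1)
    (by rw [e]; exact psum_mem_cube hy ho)
  rw [e] at this
  rw [inner_hprod_left]
  linarith [h.target_le]

/-- One step of the second phase, for a direction `x` that satisfies the linear constraint and for
which `F (x ⊕ o)` is not too small. The value at `y' ⊕ o` is bounded by concavity along the segment
from `y ⊕ o` to `y ⊕ x ⊕ o`. -/
theorem HybridValue.step {F : Vec n → ℝ} {G : Vec n → Vec n} {L D : ℝ} {P : Set (Vec n)}
    (hF : DRSubmodular F) (hG : NonnegWithGradient F G) (hL : Smooth L G)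
    (hP : DownClosedBody P) (hD : HasDiameter P D) {τ ρ η a b f : ℝ} {k : ℕ} {y x o : Vec n}
    (hτ : 0 ≤ τ) (hρ0 : 0 ≤ ρ) (hρ1 : ρ ≤ 1) (hη0 : 0 < η) (hη1 : η < 1) (ho : o ∈ P)
    (hinv : HybridInv P τ ρ η k y) (h : HybridValue F (D ^ 2 * L) η a b f o k y) (hx : x ∈ P)
    (hxo : b ≤ ρ * F (psum x o))
    (hxw : target η a b k - F y ≤ inner ℝ (hprod (slack 0 y) (G y)) x) :
    HybridValue F (D ^ 2 * L) η a b f o (k + 1) (y + η • hprod (slack 0 y) x) := by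
  have hr0 : 0 < 1 - η := by linarith
  have hrk0 : 0 < (1 - η) ^ k := pow_pos hr0 k
  have hrk1 : (1 - η) ^ k ≤ 1 := pow_le_one₀ hr0.le (by linarith)
  have hxc := hP.subset_cube hx
  have hoc := hP.subset_cube ho
  have hyc := hinv.mem_cube hρ0 hη1
  have hyc' := (hinv.step hP hτ hρ0 hη0 hη1 hx).mem_cube hρ0 hη1
  have hS : 0 ≤ D ^ 2 * L := mul_nonneg (sq_nonneg _) hL.1
  constructor
  · have hxoc := psum_mem_cube hxc hoc
    have h1 := hF.psum_ge_of_le hG hxoc hinv.nonneg hinv.le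
      (sub_nonneg.2 (mul_le_one₀ hρ1 hrk0.le hrk1)) (sub_le_self _ (by positivity))
    have hyoc := psum_mem_cube hyc hoc
    have e1 : psum y o + (psum y (psum x o) - psum y o) = psum y (psum x o) := by abel
    have h2 := hF.above_chord hG hyoc (h := psum y (psum x o) - psum y o)
      (fun u => by
        simp only [PiLp.sub_apply, psum_apply]
        have h1 : 0 ≤ (1 - y u) * ((1 - o u) * x u) :=
          mul_nonneg (by linarith [(hyc u).2])
            (mul_nonneg (by linarith [(hoc u).2]) (hxc u).1)
        linarith)
      (by rw [e1]; exact psum_mem_cube hyc hxoc) hη0.le hη1.le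
    have e2 : psum y o + η • (psum y (psum x o) - psum y o)
        = psum (y + η • hprod (slack 0 y) x) o := by
      ext u
      simp only [PiLp.add_apply, PiLp.sub_apply, PiLp.smul_apply, smul_eq_mul, psum_apply,
        hprod_apply, slack_apply, PiLp.zero_apply]
      ring
    rw [e1, e2] at h2
    rw [target_succ hη1]
    have h3 := mul_le_mul_of_nonneg_left h.target_le hr0.le
    have h4 := mul_le_mul_of_nonneg_left (mul_le_mul_of_nonneg_left hxo hrk0.le) hη0.le
    have h5 := mul_le_mul_of_nonneg_left h1 hη0.le
    linarith
  · have h1 := smooth_step hG hL hP hD hyc hyc' hx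
      (fun u => mul_nonneg (by simpa using (hyc u).2) (hxc u).1)
      (fun u => mul_le_of_le_one_left (hxc u).1 (by simpa using (hyc u).1))
    rw [inner_hprod_left] at hxw
    have h2 := mul_le_mul_of_nonneg_left hxw hη0.le
    have h3 := mul_le_mul_of_nonneg_left h.progress_le hr0.le
    have h4 := progress_succ hη0.le hη1 hS a b f k
    linarith

/-- A point from which a Frank–Wolfe step of size `γ` inside `Q` gains at most `γ g` is an
approximate local maximum with respect to every point of `Q`. -/
theorem local_max_of_small_gain {F : Vec n → ℝ} {G : Vec n → Vec n} {L D : ℝ} {P : Set (Vec n)}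
    (hF : DRSubmodular F) (hG : NonnegWithGradient F G) (hL : Smooth L G)
    (hP : DownClosedBody P) (hD : HasDiameter P D) {x v o : Vec n} {γ g : ℝ} (hx : x ∈ P)
    (hv : v ∈ P) (ho : o ∈ P) (hγ0 : 0 < γ) (hγ1 : γ ≤ 1)
    (hvo : inner ℝ (G x) o ≤ inner ℝ (G x) v)
    (hgain : F (x + γ • (v - x)) ≤ F x + γ * g) :
    1 / 2 * (F (vmax x o) + F (vmin x o)) - g / 2 - γ * (D ^ 2 * L) / 2 ≤ F x := by
  have hxc := hP.subset_cube hx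
  have h1 := hF.vmax_add_vmin_le hG hxc (hP.subset_cube ho)
  have h2 := hL.lower_bound hG hxc (h := γ • (v - x))
    (add_smul_mem_cube hxc (by simpa using hP.subset_cube hv) hγ0.le hγ1)
  rw [norm_smul, mul_pow, inner_smul_right, Real.norm_eq_abs, sq_abs] at h2
  have h3 : ‖v - x‖ ^ 2 ≤ D ^ 2 := pow_le_pow_left₀ (norm_nonneg _) (hD v hv x hx) 2
  have h4 := mul_le_mul_of_nonneg_left h3 (mul_nonneg hL.1 (sq_nonneg γ))
  have h5 : γ * inner ℝ (G x) (v - x) ≤ γ * (g + γ * (D ^ 2 * L)) := by nlinarith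
  have h6 := le_of_mul_le_mul_left h5 hγ0
  rw [inner_sub_right] at h6 h1
  linarith

/-! ### From the discrete bounds to the exponentials -/

/-- The power `(1 - σ / m) ^ (m - 1)`, written without truncated subtraction, is at least its limit
`exp (-σ)`. -/
theorem exp_neg_le_pow_div {σ : ℝ} {m : ℕ} (h0 : 0 ≤ σ) (h1 : σ ≤ 1) (hm : 2 ≤ m) :
    Real.exp (-σ) ≤ (1 - σ / m) ^ m / (1 - σ / m) := by
  have hm' : (2 : ℝ) ≤ m := by exact_mod_cast hm
  have hmσ : 0 < (m : ℝ) - σ := by linarith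
  have hr : 0 < 1 - σ / m := by
    rw [sub_pos, div_lt_one (by linarith)]; linarith
  obtain ⟨k, rfl⟩ : ∃ k, m = k + 1 := ⟨m - 1, by omega⟩
  rw [pow_succ, mul_div_cancel_right₀ _ hr.ne']
  have h2 : Real.exp (-(σ / ((k + 1 : ℕ) - σ))) ≤ 1 - σ / (k + 1 : ℕ) := by
    rw [Real.exp_neg, inv_le_comm₀ (Real.exp_pos _) hr]
    have := Real.add_one_le_exp (σ / (((k + 1 : ℕ) : ℝ) - σ))
    refine le_trans (le_of_eq ?_) this
    have : ((k + 1 : ℕ) : ℝ) ≠ 0 := by positivity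
    field_simp
    ring
  refine le_trans ?_ (pow_le_pow_left₀ (Real.exp_pos _).le h2 k)
  rw [← Real.exp_nat_mul, Real.exp_le_exp]
  have h3 : (k : ℝ) * (σ / ((k + 1 : ℕ) - σ)) ≤ σ := by
    rw [← mul_div_assoc, div_le_iff₀ hmσ]
    push_cast
    nlinarith
  linarith

theorem pow_bounds {σ : ℝ} {m : ℕ} (h0 : 0 ≤ σ) (h1 : σ ≤ 1) (hm : 2 ≤ m) :
    (1 - (m : ℝ)⁻¹) * Real.exp (-σ) ≤ (1 - σ / m) ^ m ∧ (1 - σ / m) ^ m ≤ Real.exp (-σ) := by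
  have hm' : (2 : ℝ) ≤ m := by exact_mod_cast hm
  have hr : 0 < 1 - σ / m := by
    rw [sub_pos, div_lt_one (by linarith)]; linarith
  refine ⟨?_, Real.one_sub_div_pow_le_exp_neg (by linarith)⟩
  have h2 := exp_neg_le_pow_div h0 h1 hm
  rw [le_div_iff₀ hr] at h2
  refine le_trans ?_ h2
  rw [mul_comm]
  gcongr
  rw [div_eq_mul_inv]
  exact mul_le_of_le_one_left (by positivity) h1

set_option maxHeartbeats 1000000 in
/-- Integrating both phases: the bounds maintained by the two phases add up to the first
alternative of the guarantee. Here `A`, `Y`, `Z` stand for `F o`, `F (z ⊙ o)`, `F (z ⊕ o)`, and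
`f`, `g` for the values reached after the first and the second phase. -/
theorem large_value_arith {ts ε δ A Y Z S f g a b : ℝ} {m : ℕ} (hts0 : 0 < ts) (hts1 : ts < 1)
    (hε : 0 < ε) (hm : 2 ≤ m) (hmε : (m : ℝ)⁻¹ ≤ ε) (hmδ : (m : ℝ)⁻¹ ≤ δ)
    (hY0 : 0 ≤ Y) (hYA : Y ≤ A) (hZ0 : 0 ≤ Z) (hZA : Z ≤ 2 * A) (hS : 0 ≤ S)
    (hf0 : 0 ≤ f) (hfA : f ≤ A) (ha0 : 0 ≤ a) (hb0 : 0 ≤ b) (hbA : b ≤ 2 * A)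
    (hf : (1 - (1 - ts / m) ^ m) * (A - Y - Z)
      + m * (ts / m) * ((1 - ts / m) ^ m / (1 - ts / m)) * Z - m * (ts / m) ^ 2 * S ≤ f)
    (ha : A - (1 - (1 - ts / m) ^ m) * Z - ε * A ≤ a)
    (hb : (1 - ts / m) ^ m * (Z - ε * A) - ε * A ≤ b)
    (hg : progress ((1 - ts) / m) S a b f m ≤ g) :
    Real.exp (-1) * (((2 - ts) * Real.exp ts - 1 - 30 * ε) * A - (Real.exp ts - 1) * Y
      - ((2 - ts) * Real.exp ts + ts - (ts ^ 2 + 5) / 2) * Z) - 2 * (δ * S) ≤ g := by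
  have hm' : (2 : ℝ) ≤ m := by exact_mod_cast hm
  have hm0 : (m : ℝ) ≠ 0 := by linarith
  have hA : 0 ≤ A := hf0.trans hfA
  obtain ⟨σ, hσ⟩ : ∃ σ, σ = 1 - ts := ⟨_, rfl⟩
  have hσ0 : 0 < σ := by linarith
  have hσ1 : σ ≤ 1 := by linarith
  have hu0 : 0 < (m : ℝ)⁻¹ := by positivity
  obtain ⟨q1, q2⟩ := pow_bounds hts0.le hts1.le hm
  have q3 := exp_neg_le_pow_div hts0.le hts1.le hm
  obtain ⟨p1, -⟩ := pow_bounds hσ0.le hσ1 hm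
  have p3 := exp_neg_le_pow_div hσ0.le hσ1 hm
  have hr0 : 0 < 1 - σ / m := by
    rw [sub_pos, div_lt_one (by linarith)]; linarith
  have hr1 : 1 - σ / m ≤ 1 := by
    have : 0 ≤ σ / m := by positivity
    linarith
  have p4 : Real.exp (-σ) ≤ (1 - σ / m) ^ m / (1 - σ / m) ^ 2 := by
    refine p3.trans ?_
    gcongr
    nlinarith
  rw [progress, ← hσ] at hg
  set q := (1 - ts / m) ^ m
  set Q := q / (1 - ts / m)
  set u := (m : ℝ)⁻¹ with hu
  have eσ : Real.exp (-σ) = Real.exp (-1) * Real.exp ts := by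
    rw [← Real.exp_add]; congr 1; rw [hσ]; ring
  set W := Real.exp (-σ)
  have hW0 : 0 < W := Real.exp_pos _
  have hW1 : W ≤ 1 := Real.exp_le_one_iff.2 (by linarith)
  set E := Real.exp ts
  set e := Real.exp (-ts)
  have he0 : 0 < e := Real.exp_pos _
  have he1 : e ≤ 1 := Real.exp_le_one_iff.2 (by linarith)
  have hEe : E * e = 1 := by rw [← Real.exp_add]; simp
  have hE : E ≤ 3 := by
    have h1 : E ≤ Real.exp 1 := Real.exp_le_exp.2 hts1.le
    linarith [Real.exp_one_lt_d9]
  have hw0 : 0 < Real.exp (-1) := Real.exp_pos _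
  have heq : e - q ≤ ε := by
    have : u * e ≤ ε * 1 := by gcongr
    linarith
  -- The value after the first phase: replacing `q` by its limit `e` costs `3 ε A`, as
  -- `|A - Y - Z| ≤ 3 A`.
  have f1 : (1 - e) * (A - Y - Z) + ts * e * Z - 3 * ε * A - δ * S ≤ f := by
    have h1 : (m : ℝ) * (ts / m) = ts := by field_simp
    have h2 : (m : ℝ) * (ts / m) ^ 2 = ts ^ 2 * u := by rw [hu]; field_simp
    rw [h1, h2] at hf
    have h3 : ts * e * Z ≤ ts * Q * Z := by gcongr
    have h4 : ts ^ 2 * u * S ≤ δ * S := by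
      gcongr
      calc ts ^ 2 * u ≤ 1 * u := by gcongr; exact pow_le_one₀ (by linarith) (by linarith)
        _ ≤ δ := by rwa [one_mul]
    have h5 : 0 ≤ e - q := by linarith
    have h7 : -(3 * A) * (e - q) ≤ (A - Y - Z) * (e - q) := by gcongr; linarith
    have h8 : (3 * A) * (e - q) ≤ 3 * A * ε := by gcongr
    linarith
  have hq1 : q ≤ 1 := by linarith
  have hq0 : 0 ≤ q := by
    have : 0 ≤ 1 - u := by
      have : u ≤ 2⁻¹ := by rw [hu]; gcongr
      linarith
    exact le_trans (by positivity) q1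
  have a1 : A - (1 - e) * Z - 3 * ε * A ≤ a := by
    have : (e - q) * Z ≤ ε * (2 * A) := by gcongr
    linarith
  have b1 : e * Z - 4 * ε * A ≤ b := by
    have h1 : (e - q) * Z ≤ ε * (2 * A) := by gcongr
    have h2 : q * (ε * A) ≤ ε * A := mul_le_of_le_one_left (by positivity) hq1
    linarith
  -- The value after the second phase: all powers of `1 - σ / m` are bounded below by `W`, up to
  -- factors `1 - ε`, which is possible because `f`, `a` and `b` are non-negative.
  have g1 : W * ((1 - ε) * f + σ * a + σ ^ 2 / 2 * ((1 - ε) * b)) - δ * S ≤ g := by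
    refine le_trans ?_ hg
    have h1 : (m : ℝ) * (σ / m) = σ := by field_simp
    have h2 : (m : ℝ) * (σ / m) ^ 2 = σ ^ 2 * u := by rw [hu]; field_simp
    have h3 : (σ / m) ^ 2 * (m * (m - 1) / 2) = σ ^ 2 / 2 * (1 - u) := by
      rw [hu]; field_simp
    rw [h1, h2, h3]
    have h4 : σ ^ 2 * u * S ≤ δ * S := by
      gcongr
      calc σ ^ 2 * u ≤ 1 * u := by gcongr; exact pow_le_one₀ (by linarith) (by linarith)
        _ ≤ δ := by linarith
    have h5 : W * ((1 - ε) * f) ≤ (1 - σ / m) ^ m * f := by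
      rw [← mul_assoc]
      gcongr
      refine le_trans ?_ p1
      rw [mul_comm]
      gcongr
    have h6 : W * (σ * a) ≤ (1 - σ / m) ^ m / (1 - σ / m) * (σ * a) := by gcongr
    have h7 : W * (σ ^ 2 / 2 * ((1 - ε) * b))
        ≤ (1 - σ / m) ^ m / (1 - σ / m) ^ 2 * (σ ^ 2 / 2 * ((1 - u) * b)) := by
      have : 0 ≤ 1 - u := by
        have : u ≤ 2⁻¹ := by rw [hu]; gcongr
        linarith
      calc W * (σ ^ 2 / 2 * ((1 - ε) * b)) ≤ W * (σ ^ 2 / 2 * ((1 - u) * b)) := by gcongr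
        _ ≤ _ := by gcongr
    have h8 : (1 - σ / m) ^ m * (f + σ * a / (1 - σ / m)
        + σ ^ 2 / 2 * (1 - u) * b / (1 - σ / m) ^ 2)
      = (1 - σ / m) ^ m * f + (1 - σ / m) ^ m / (1 - σ / m) * (σ * a)
        + (1 - σ / m) ^ m / (1 - σ / m) ^ 2 * (σ ^ 2 / 2 * ((1 - u) * b)) := by
      field_simp
    rw [h8]
    linarith
  have g2 : (1 - e) * (A - Y - Z) + ts * e * Z + σ * (A - (1 - e) * Z) + σ ^ 2 / 2 * (e * Z)
      - 10 * ε * A - δ * S ≤ (1 - ε) * f + σ * a + σ ^ 2 / 2 * ((1 - ε) * b) := by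
    have hσ2 : σ ^ 2 ≤ 1 := by nlinarith
    have h1 : ε * f ≤ ε * A := by gcongr
    have h2 := mul_le_mul_of_nonneg_left a1 hσ0.le
    have h3 : σ * (3 * ε * A) ≤ 1 * (3 * ε * A) := by gcongr
    have h4 := mul_le_mul_of_nonneg_left b1 (show 0 ≤ σ ^ 2 / 2 by positivity)
    have h5 : σ ^ 2 / 2 * (4 * ε * A) ≤ 1 / 2 * (4 * ε * A) := by gcongr
    have h6 : σ ^ 2 / 2 * (ε * b) ≤ 1 / 2 * (ε * (2 * A)) := by gcongr
    linarith
  have g3 := mul_le_mul_of_nonneg_left g2 hW0.le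
  have g4 : W * (δ * S) ≤ 1 * (δ * S) := by
    have : 0 ≤ δ := hu0.le.trans hmδ
    gcongr
  have g5 : W * (10 * ε * A) ≤ Real.exp (-1) * (30 * ε * A) := by
    rw [eσ, mul_assoc]
    have : E * (10 * ε * A) ≤ 3 * (10 * ε * A) := by gcongr
    exact mul_le_mul_of_nonneg_left (by linarith) hw0.le
  have g6 : W * ((1 - e) * (A - Y - Z) + ts * e * Z + σ * (A - (1 - e) * Z)
        + σ ^ 2 / 2 * (e * Z))
      = Real.exp (-1) * (((2 - ts) * E - 1) * A - (E - 1) * Y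
      - ((2 - ts) * E + ts - (ts ^ 2 + 5) / 2) * Z) := by
    rw [eσ, hσ]
    linear_combination Real.exp (-1) * (-(A - Y - Z) + ts * Z + (1 - ts) * Z
      + (1 - ts) ^ 2 / 2 * Z) * hEe
  linarith

/-- The first alternative of the guarantee is void when `F o` is of the order of the smoothness
error. -/
theorem large_value_of_small {ts ε δ A Y Z S g : ℝ} (hts0 : 0 < ts) (hts1 : ts < 1)
    (hε : 0 < ε) (hA : 0 ≤ A) (hY0 : 0 ≤ Y) (hZ0 : 0 ≤ Z) (hZA : Z ≤ 2 * A)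
    (hsmall : A ≤ 100 * (δ * S)) (hg : 0 ≤ g) :
    Real.exp (-1) * (((2 - ts) * Real.exp ts - 1 - 1000 * ε) * A - (Real.exp ts - 1) * Y
      - ((2 - ts) * Real.exp ts + ts - (ts ^ 2 + 5) / 2) * Z) - 1000 * (δ * S) ≤ g := by
  have hE1 : 1 ≤ Real.exp ts := Real.one_le_exp hts0.le
  have hE : Real.exp ts ≤ 3 := by
    have h1 : Real.exp ts ≤ Real.exp 1 := Real.exp_le_exp.2 hts1.le
    linarith [Real.exp_one_lt_d9]
  set E := Real.exp ts
  have hw0 : 0 < Real.exp (-1) := Real.exp_pos _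
  have hw1 : Real.exp (-1) ≤ 1 := Real.exp_le_one_iff.2 (by norm_num)
  have h1 : ((2 - ts) * E - 1 - 1000 * ε) * A ≤ 5 * A := by gcongr; nlinarith
  have h2 : 0 ≤ (E - 1) * Y := mul_nonneg (by linarith) hY0
  have h3 : (-(5 / 2)) * Z ≤ ((2 - ts) * E + ts - (ts ^ 2 + 5) / 2) * Z := by
    gcongr
    nlinarith
  calc _ ≤ Real.exp (-1) * (10 * A) - 1000 * (δ * S) := by gcongr; linarith
    _ ≤ 1 * (10 * A) - 1000 * (δ * S) := by gcongr
    _ ≤ g := by linarith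

/-! ### Frames of commands -/

/-- `c` contains no write to register `v`. -/
def Cmd.keepsReg (v : ℕ) : Cmd → Bool
  | .nset w _ => w != v
  | .seq c₁ c₂ => c₁.keepsReg v && c₂.keepsReg v
  | .ite _ c₁ c₂ => c₁.keepsReg v && c₂.keepsReg v
  | .loop _ c => c.keepsReg v
  | .callLin _ _ _ _ _ flag => flag != v
  | _ => true

/-- `c` contains no write to array `b`. -/
def Cmd.keepsArr (b : ℕ) : Cmd → Bool
  | .rset a _ _ => a != b
  | .seq c₁ c₂ => c₁.keepsArr b && c₂.keepsArr b
  | .ite _ c₁ c₂ => c₁.keepsArr b && c₂.keepsArr b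
  | .loop _ c => c.keepsArr b
  | .callVal _ a _ => a != b
  | .callGrad _ a => a != b
  | .callLin _ _ _ _ a _ => a != b
  | _ => true

/-- `c` contains no output command. -/
def Cmd.silent : Cmd → Bool
  | .seq c₁ c₂ => c₁.silent && c₂.silent
  | .ite _ c₁ c₂ => c₁.silent && c₂.silent
  | .loop _ c => c.silent
  | .emit _ => false
  | _ => true

/-- `s'` differs from `s` only where the text of `c` allows it. -/
structure Frame (c : Cmd) (s s' : State n) : Prop where
  reg : ∀ v, c.keepsReg v = true → s'.reg v = s.reg v
  arr : ∀ a, c.keepsArr a = true → s'.arr a = s.arr a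
  out : c.silent = true → s'.out = s.out

theorem Frame.refl (c : Cmd) (s : State n) : Frame c s s :=
  ⟨fun _ _ => rfl, fun _ _ => rfl, fun _ => rfl⟩

theorem Frame.trans {c : Cmd} {s₁ s₂ s₃ : State n} (h₁ : Frame c s₁ s₂) (h₂ : Frame c s₂ s₃) :
    Frame c s₁ s₃ :=
  ⟨fun v hv => (h₂.reg v hv).trans (h₁.reg v hv), fun a ha => (h₂.arr a ha).trans (h₁.arr a ha),
    fun h => (h₂.out h).trans (h₁.out h)⟩

theorem Frame.vec {c : Cmd} {s s' : State n} (h : Frame c s s') (a : ℕ)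
    (ha : c.keepsArr a = true) : s'.vec a = s.vec a := by
  simp only [State.vec, h.arr a ha]

theorem Exec.frame {O : Oracles n} {d : ℕ} {c : Cmd} {s s' : State n} {t : ℕ}
    (h : Exec O d c s s' t) : Frame c s s' := by
  induction h with
  | nop s => exact Frame.refl _ _
  | nset s v e =>
    refine ⟨fun w hw => ?_, fun _ _ => rfl, fun _ => rfl⟩
    have : v ≠ w := by simpa [Cmd.keepsReg] using hw
    simp [State.setReg, this.symm]
  | rset s a i e =>
    refine ⟨fun _ _ => rfl, fun b hb => ?_, fun _ => rfl⟩
    have : a ≠ b := by simpa [Cmd.keepsArr] using hb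
    simp [State.setEntry, this.symm]
  | seq _ _ h₁ h₂ =>
    refine ⟨fun v hv => ?_, fun a ha => ?_, fun h => ?_⟩
    · simp only [Cmd.keepsReg, Bool.and_eq_true] at hv
      exact (h₂.reg v hv.2).trans (h₁.reg v hv.1)
    · simp only [Cmd.keepsArr, Bool.and_eq_true] at ha
      exact (h₂.arr a ha.2).trans (h₁.arr a ha.1)
    · simp only [Cmd.silent, Bool.and_eq_true] at h
      exact (h₂.out h.2).trans (h₁.out h.1)
  | ite_true _ _ h₁ =>
    refine ⟨fun v hv => ?_, fun a ha => ?_, fun h => ?_⟩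
    · simp only [Cmd.keepsReg, Bool.and_eq_true] at hv
      exact h₁.reg v hv.1
    · simp only [Cmd.keepsArr, Bool.and_eq_true] at ha
      exact h₁.arr a ha.1
    · simp only [Cmd.silent, Bool.and_eq_true] at h
      exact h₁.out h.1
  | ite_false _ _ h₁ =>
    refine ⟨fun v hv => ?_, fun a ha => ?_, fun h => ?_⟩
    · simp only [Cmd.keepsReg, Bool.and_eq_true] at hv
      exact h₁.reg v hv.2
    · simp only [Cmd.keepsArr, Bool.and_eq_true] at ha
      exact h₁.arr a ha.2
    · simp only [Cmd.silent, Bool.and_eq_true] at h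
      exact h₁.out h.2
  | loop_done _ => exact Frame.refl _ _
  | loop_step _ _ _ h₁ h₂ =>
    exact ⟨fun v hv => (h₂.reg v hv).trans (h₁.reg v hv),
      fun a ha => (h₂.arr a ha).trans (h₁.arr a ha), fun h => (h₂.out h).trans (h₁.out h)⟩
  | callVal s src a i =>
    refine ⟨fun _ _ => rfl, fun b hb => ?_, fun _ => rfl⟩
    have : a ≠ b := by simpa [Cmd.keepsArr] using hb
    simp [State.setEntry, this.symm]
  | callGrad s src a =>
    refine ⟨fun _ _ => rfl, fun b hb => ?_, fun _ => rfl⟩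
    have : a ≠ b := by simpa [Cmd.keepsArr] using hb
    simp [State.setVec, this.symm]
  | @callLin_some s w A B a flag k x _ =>
    refine ⟨fun v hv => ?_, fun b hb => ?_, fun _ => rfl⟩
    · have : flag ≠ v := by simpa [Cmd.keepsReg] using hv
      simp [State.setReg, State.setVec, this.symm]
    · have : a ≠ b := by simpa [Cmd.keepsArr] using hb
      simp [State.setReg, State.setVec, this.symm]
  | @callLin_none s w A B a flag k _ =>
    refine ⟨fun v hv => ?_, fun b hb => rfl, fun _ => rfl⟩
    have : flag ≠ v := by simpa [Cmd.keepsReg] using hv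
    simp [State.setReg, this.symm]
  | emit s src =>
    exact ⟨fun _ _ => rfl, fun _ _ => rfl, fun h => by simp [Cmd.silent] at h⟩

/-! ### Reading from updated states -/

section Read

variable (s : State n) (a b i j v w k : ℕ) (r : ℝ) (x : Vec n)

@[simp] theorem State.setReg_reg_self : (s.setReg v k).reg v = k := by simp [State.setReg]

@[simp] theorem State.setReg_reg_ne (h : w ≠ v) : (s.setReg v k).reg w = s.reg w := by
  simp [State.setReg, h]

@[simp] theorem State.setReg_arr : (s.setReg v k).arr = s.arr := rfl

@[simp] theorem State.setReg_out : (s.setReg v k).out = s.out := rfl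

@[simp] theorem State.setReg_vec : (s.setReg v k).vec a = s.vec a := rfl

@[simp] theorem State.setEntry_reg : (s.setEntry a i r).reg = s.reg := rfl

@[simp] theorem State.setEntry_out : (s.setEntry a i r).out = s.out := rfl

@[simp] theorem State.setEntry_arr_self : (s.setEntry a i r).arr a i = r := by
  simp [State.setEntry]

@[simp] theorem State.setEntry_arr_ne (h : b ≠ a) : (s.setEntry a i r).arr b = s.arr b := by
  simp [State.setEntry, h]

@[simp] theorem State.setEntry_vec_ne (h : b ≠ a) : (s.setEntry a i r).vec b = s.vec b := by
  simp [State.vec, h]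

@[simp] theorem State.setVec_reg : (s.setVec a x).reg = s.reg := rfl

@[simp] theorem State.setVec_out : (s.setVec a x).out = s.out := rfl

@[simp] theorem State.setVec_arr_ne (h : b ≠ a) : (s.setVec a x).arr b = s.arr b := by
  simp [State.setVec, h]

@[simp] theorem State.setVec_vec_ne (h : b ≠ a) : (s.setVec a x).vec b = s.vec b := by
  simp [State.vec, h]

@[simp] theorem State.setVec_vec_self : (s.setVec a x).vec a = x := by
  ext u
  simp [State.vec, State.setVec]

@[simp] theorem State.setVec_arr_self (u : Fin n) : (s.setVec a x).arr a u = x u := by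
  simp [State.setVec]

theorem State.arr_eq_vec (u : Fin n) : s.arr a u = s.vec a u := rfl

theorem State.setVec_vec : s.setVec a (s.vec a) = s := by
  have : (fun j => if h : j < n then s.vec a ⟨j, h⟩ else s.arr a j) = s.arr a := by
    funext j
    split_ifs <;> rfl
  rw [State.setVec, this, Function.update_eq_self]

theorem State.setReg_setReg : (s.setReg v k).setReg v w = s.setReg v w := by
  simp [State.setReg]

theorem State.constraints_zero : s.constraints a b 0 = [] := rfl

theorem State.constraints_one : s.constraints a b 1 = [(s.vec a, s.arr b 0)] := by
  simp [State.constraints, State.vec]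

end Read

/-! ### Program logic with time bounds -/

/-- The unit in which running times are measured; it exceeds the cost of a single oracle call with
at most one linear constraint, and the cost of a simple loop over the coordinates. -/
def timeUnit (n d : ℕ) : ℕ := 100 * (n + 3) ^ (d + 1)

/-- Started in `s`, the program `c` halts within `N` time units in a state that satisfies `Q`. -/
def Runs (O : Oracles n) (d : ℕ) (c : Cmd) (s : State n) (N : ℕ) (Q : State n → Prop) : Prop :=
  ∃ s' t, Exec O d c s s' t ∧ t ≤ N * timeUnit n d ∧ Q s'

theorem timeUnit_ge (n d : ℕ) : 100 * (n + 1) ≤ timeUnit n d :=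
  Nat.mul_le_mul_left _ ((show n + 1 ≤ n + 3 by omega).trans
    (Nat.le_self_pow (by omega) (n + 3)))

theorem timeUnit_ge_oracle (n d : ℕ) {k : ℕ} (hk : k ≤ 1) :
    50 + n + (n + k + 2) ^ d + 1 ≤ timeUnit n d := by
  have h1 : (n + k + 2) ^ d ≤ (n + 3) ^ d := Nat.pow_le_pow_left (by omega) d
  have h2 : 1 ≤ (n + 3) ^ d := Nat.one_le_pow _ _ (by omega)
  have h3 : timeUnit n d = 100 * ((n + 3) ^ d * (n + 3)) := by rw [timeUnit, pow_succ]
  nlinarith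

section Rules

variable {O : Oracles n} {d : ℕ} {s : State n} {Q : State n → Prop}

theorem Runs.mono {c : Cmd} {N N' : ℕ} {R : State n → Prop} (h : Runs O d c s N R) (hN : N ≤ N')
    (hQ : ∀ s', Frame c s s' → R s' → Q s') : Runs O d c s N' Q := by
  obtain ⟨s', t, he, ht, hr⟩ := h
  exact ⟨s', t, he, ht.trans (Nat.mul_le_mul_right _ hN), hQ s' he.frame hr⟩

/-- Time budgets of consecutive commands add up. -/
theorem Runs.seq {c₁ c₂ : Cmd} {N₁ N₂ : ℕ}
    (h : Runs O d c₁ s N₁ fun s' => Runs O d c₂ s' N₂ Q) :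
    Runs O d (.seq c₁ c₂) s (N₁ + N₂) Q := by
  obtain ⟨s₁, t₁, h₁, ht₁, s₂, t₂, h₂, ht₂, hq⟩ := h
  exact ⟨s₂, t₁ + t₂, h₁.seq h₂, by rw [add_mul]; exact add_le_add ht₁ ht₂, hq⟩

theorem Runs.nop (h : Q s) : Runs O d .nop s 1 Q :=
  ⟨s, 1, .nop s, by have := timeUnit_ge n d; omega, h⟩

theorem Runs.nset {v : ℕ} {e : NExpr} (he : e.cost ≤ 50) (h : Q (s.setReg v (e.eval s))) :
    Runs O d (.nset v e) s 1 Q :=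
  ⟨_, _, .nset s v e, by have := timeUnit_ge n d; omega, h⟩

theorem Runs.rset {a : ℕ} {i : NExpr} {e : RExpr} (he : i.cost + e.cost ≤ 50)
    (h : Q (s.setEntry a (i.eval s) (e.eval s))) : Runs O d (.rset a i e) s 1 Q :=
  ⟨_, _, .rset s a i e, by have := timeUnit_ge n d; omega, h⟩

theorem Runs.callVal {src a : ℕ} (h : Q (s.setEntry a 0 (O.val (s.vec src)))) :
    Runs O d (.callVal src a (.lit 0)) s 1 Q :=
  ⟨_, _, .callVal s src a (.lit 0), by
    have := timeUnit_ge_oracle n d (k := 0) (by omega)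
    simp only [NExpr.cost, add_zero] at *
    omega, h⟩

theorem Runs.callGrad {src a : ℕ} (h : Q (s.setVec a (O.grad (s.vec src)))) :
    Runs O d (.callGrad src a) s 1 Q :=
  ⟨_, _, .callGrad s src a, by
    have := timeUnit_ge_oracle n d (k := 0) (by omega)
    simp only [add_zero] at *
    omega, h⟩

theorem Runs.emit {src : ℕ} (h : Q { s with out := s.out ++ [s.vec src] }) :
    Runs O d (.emit src) s 1 Q :=
  ⟨_, _, .emit s src, by have := timeUnit_ge n d; omega, h⟩

/-- An infeasible call leaves the target array unchanged, so both outcomes of a call write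
`(O.lin _ _).getD (s.vec a)`. -/
theorem Runs.callLin {w A B a flag k : ℕ} (hk : k ≤ 1)
    (h : ∀ j, Q ((s.setVec a ((O.lin (s.constraints A B k) (s.vec w)).getD (s.vec a))).setReg
      flag j)) :
    Runs O d (.callLin w A B (.lit k) a flag) s 1 Q := by
  have ht := timeUnit_ge_oracle n d hk
  cases hl : O.lin (s.constraints A B k) (s.vec w) with
  | none =>
    refine ⟨_, _, .callLin_none hl, ?_, ?_⟩
    · simp only [NExpr.cost, NExpr.eval]
      omega
    · have := h 0
      rwa [hl, Option.getD_none, State.setVec_vec] at this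
  | some x =>
    refine ⟨_, _, .callLin_some hl, ?_, ?_⟩
    · simp only [NExpr.cost, NExpr.eval]
      omega
    · have := h 1
      rwa [hl, Option.getD_some] at this

theorem Runs.ite {b : BExpr} {c₁ c₂ : Cmd} {N : ℕ} (hb : b.cost ≤ 50)
    (h₁ : b.holds s → Runs O d c₁ s N Q) (h₂ : ¬ b.holds s → Runs O d c₂ s N Q) :
    Runs O d (.ite b c₁ c₂) s (N + 1) Q := by
  have := timeUnit_ge n d
  by_cases h : b.holds s
  · obtain ⟨s', t, he, ht, hq⟩ := h₁ h
    exact ⟨s', _, .ite_true h he, by rw [add_mul]; omega, hq⟩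
  · obtain ⟨s', t, he, ht, hq⟩ := h₂ h
    exact ⟨s', _, .ite_false h he, by rw [add_mul]; omega, hq⟩

/-- A loop with a known number `M` of iterations and an invariant. -/
theorem Runs.loop {b : BExpr} {c : Cmd} {M B : ℕ} (I : ℕ → State n → Prop) (hb : b.cost ≤ 50)
    (hguard : ∀ i s', i ≤ M → I i s' → (b.holds s' ↔ i < M))
    (hstep : ∀ i s', i < M → Frame c s s' → I i s' → Runs O d c s' B (I (i + 1)))
    (h0 : I 0 s) : Runs O d (.loop b c) s (M * (B + 1) + 1) (I M) := by
  have hu := timeUnit_ge n d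
  have key : ∀ k i s', i + k = M → Frame c s s' → I i s' →
      Runs O d (.loop b c) s' (k * (B + 1) + 1) (I M) := by
    intro k
    induction k with
    | zero =>
      intro i s' hi _ hI
      obtain rfl : i = M := by omega
      exact ⟨s', _, .loop_done (by rw [hguard i s' le_rfl hI]; omega), by omega, hI⟩
    | succ k ih =>
      intro i s' hi hf hI
      obtain ⟨s₁, t₁, he₁, ht₁, hI₁⟩ := hstep i s' (by omega) hf hI
      obtain ⟨s₂, t₂, he₂, ht₂, hI₂⟩ := ih (i + 1) s₁ (by omega) (hf.trans he₁.frame) hI₁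
      refine ⟨s₂, _, .loop_step ((hguard i s' (by omega) hI).2 (by omega)) he₁ he₂, ?_, hI₂⟩
      have : ((k + 1) * (B + 1) + 1) * timeUnit n d
          = B * timeUnit n d + (k * (B + 1) + 1) * timeUnit n d + timeUnit n d := by ring
      omega
  exact key M 0 s (by omega) (Frame.refl _ _) h0

end Rules

/-- Increase register `v`, which is `0` initially, until `b` holds. -/
def Cmd.count (v : ℕ) (b : BExpr) : Cmd :=
  .loop (.not b) (.nset v (.add (.reg v) (.lit 1)))

/-- Run `c` once for each value of register `v` below that of register `w`. -/
def Cmd.forLoop (v w : ℕ) (c : Cmd) : Cmd :=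
  .seq (.nset v (.lit 0))
    (.loop (.nle (.add (.reg v) (.lit 1)) (.reg w))
      (.seq c (.nset v (.add (.reg v) (.lit 1)))))

/-- Fill the first `n` entries of array `a` with the values of `e`, in which register `1` holds
the index. -/
def Cmd.fill (a : ℕ) (e : RExpr) : Cmd := .forLoop 1 0 (.rset a (.reg 1) e)

section Rules

variable {O : Oracles n} {d : ℕ} {s : State n} {Q : State n → Prop}

/-- The counting loop stops at the least `N` that satisfies `p`. -/
theorem Runs.count {v N : ℕ} {b : BExpr} {p : ℕ → Prop} (hb : b.cost ≤ 49)
    (hp : ∀ k, b.holds (s.setReg v k) ↔ p k) (h0 : s.reg v = 0) (hN : p N)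
    (hlt : ∀ k < N, ¬ p k) (h : Q (s.setReg v N)) :
    Runs O d (.count v b) s (N * 2 + 1) Q := by
  have := Runs.loop (O := O) (d := d) (s := s) (b := .not b)
    (c := .nset v (.add (.reg v) (.lit 1))) (M := N) (B := 1) (fun i s' => s' = s.setReg v i)
    (by simp only [BExpr.cost]; omega)
    (by
      rintro i s' hi rfl
      simp only [BExpr.holds, hp]
      constructor
      · intro hpi
        rcases hi.lt_or_eq with h | rfl
        · exact h
        · exact absurd hN hpi
      · exact hlt i)
    (by
      rintro i s' hi - rfl
      refine Runs.nset (by simp [NExpr.cost]) ?_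
      simp [NExpr.eval, State.setReg_setReg])
    (by rw [← h0]; simp [State.setReg])
  exact this.mono le_rfl fun s' _ hs' => by rw [hs']; exact h

/-- The rule for counting loops. The invariant must not mention the counter. -/
theorem Runs.forLoop {v w M B : ℕ} {c : Cmd} (I : ℕ → State n → Prop) (hvw : v ≠ w)
    (hv : c.keepsReg v = true) (hw : c.keepsReg w = true) (hM : s.reg w = M)
    (hI : ∀ i k s', I i s' → I i (s'.setReg v k))
    (hstep : ∀ i s', i < M → Frame (.forLoop v w c) s s' → s'.reg v = i → I i s' →
      Runs O d c s' B (I (i + 1)))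
    (h0 : I 0 s) : Runs O d (.forLoop v w c) s (M * (B + 2) + 2) (I M) := by
  have hframe : ∀ {s'}, Frame (.seq c (.nset v (.add (.reg v) (.lit 1)))) (s.setReg v 0) s' →
      Frame (.forLoop v w c) s s' := by
    intro s' hf
    refine ⟨fun r hr => ?_, fun a ha => ?_, fun h => ?_⟩
    · have hr' : v ≠ r ∧ c.keepsReg r = true ∧ v ≠ r := by
        simpa [Cmd.forLoop, Cmd.keepsReg] using hr
      rw [hf.reg r (by simp [Cmd.keepsReg, hr'.1, hr'.2.1]),
        State.setReg_reg_ne _ _ _ _ hr'.1.symm]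
    · exact hf.arr a (by simpa [Cmd.forLoop, Cmd.keepsArr] using ha)
    · exact hf.out (by simpa [Cmd.forLoop, Cmd.silent] using h)
  have key := Runs.loop (O := O) (d := d) (s := s.setReg v 0)
    (b := .nle (.add (.reg v) (.lit 1)) (.reg w))
    (c := .seq c (.nset v (.add (.reg v) (.lit 1)))) (M := M) (B := B + 1)
    (fun i s' => s'.reg v = i ∧ s'.reg w = M ∧ I i s')
    (by simp [BExpr.cost, NExpr.cost])
    (by
      rintro i s' - ⟨h1, h2, -⟩
      simp only [BExpr.holds, NExpr.eval, h1, h2]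
      omega)
    (by
      rintro i s' hi hf ⟨h1, h2, h3⟩
      refine Runs.seq ((hstep i s' hi (hframe hf) h1 h3).mono le_rfl fun s₁ hf₁ hI₁ => ?_)
      refine Runs.nset (by simp [NExpr.cost]) ⟨?_, ?_, hI _ _ _ hI₁⟩
      · simp [NExpr.eval, hf₁.reg v hv, h1]
      · rw [State.setReg_reg_ne _ _ _ _ hvw.symm, hf₁.reg w hw, h2])
    ⟨by simp, by rw [State.setReg_reg_ne _ _ _ _ hvw.symm, hM], hI _ _ _ h0⟩
  refine Runs.mono (Runs.seq (N₁ := 1) (Runs.nset (by simp [NExpr.cost]) key)) (by ring_nf; omega)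
    fun s' _ h => h.2.2

/-- The expression `e` may read entry `u` of the array that is being filled, which still holds its
old value when index `u` is reached. -/
theorem Runs.fill {a : ℕ} {e : RExpr} (he : e.cost ≤ 50) (hn : s.reg 0 = n) {x : Vec n}
    (hx : ∀ (u : Fin n) (s' : State n), s'.reg 1 = u → (∀ r ≠ 1, s'.reg r = s.reg r) →
      (∀ b ≠ a, s'.arr b = s.arr b) → s'.arr a u = s.arr a u → e.eval s' = x u)
    (h : ∀ k, Q ((s.setVec a x).setReg 1 k)) : Runs O d (.fill a e) s 1 Q := by
  -- The exact state after `i` iterations; the loop takes `O(n)` steps, a single time unit.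
  let st : ℕ → ℕ → State n := fun i k =>
    { reg := Function.update s.reg 1 k
      arr := Function.update s.arr a fun j =>
        if h : j < n then (if j < i then x ⟨j, h⟩ else s.arr a j) else s.arr a j
      out := s.out }
  have hst : ∀ k i, i + k = n → ∃ t, Exec O d
      (.loop (.nle (.add (.reg 1) (.lit 1)) (.reg 0))
        (.seq (.rset a (.reg 1) e) (.nset 1 (.add (.reg 1) (.lit 1))))) (st i i) (st n n) t ∧
      t ≤ 70 * k + 10 := by
    intro k
    induction k with
    | zero =>
      intro i hi
      obtain rfl : i = n := by omega
      refine ⟨_, .loop_done ?_, ?_⟩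
      · simp [BExpr.holds, NExpr.eval, st, hn]
      · simp [BExpr.cost, NExpr.cost]
    | succ k ih =>
      intro i hi
      obtain ⟨t, he₂, ht⟩ := ih (i + 1) (by omega)
      have hi' : i < n := by omega
      have heval : e.eval (st i i) = x ⟨i, hi'⟩ :=
        hx ⟨i, hi'⟩ _ (by simp [st]) (fun r hr => by simp [st, hr])
          (fun b hb => by simp [st, hb]) (by simp [st])
      have e1 : ((st i i).setEntry a ((NExpr.reg 1).eval (st i i)) (e.eval (st i i))).setReg 1
          ((NExpr.add (.reg 1) (.lit 1)).eval
            ((st i i).setEntry a ((NExpr.reg 1).eval (st i i)) (e.eval (st i i))))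
          = st (i + 1) (i + 1) := by
        rw [heval]
        simp only [NExpr.eval, State.setReg, State.setEntry, st, Function.update_self,
          Function.update_idem, State.mk.injEq, and_true, true_and]
        congr 1
        funext j
        by_cases hj : j = i
        · subst hj; simp [hi']
        · rw [Function.update_of_ne hj]
          have : j < i + 1 ↔ j < i := by omega
          simp only [this]
      refine ⟨_, .loop_step (s₂ := st (i + 1) (i + 1)) ?_ (e1 ▸ (Exec.rset _ _ _ _).seq
        (Exec.nset _ _ _)) he₂, ?_⟩
      · simp [BExpr.holds, NExpr.eval, st, hn]
        omega
      · simp only [BExpr.cost, NExpr.cost]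
        omega
  obtain ⟨t, hE, ht⟩ := hst n 0 (by omega)
  have e0 : s.setReg 1 0 = st 0 0 := by
    simp [State.setReg, st]
  have e2 : st n n = (s.setVec a x).setReg 1 n := by
    simp only [State.setReg, State.setVec, st, State.mk.injEq, and_true, true_and]
    congr 1
    funext j
    split_ifs <;> rfl
  refine ⟨_, _, (Exec.nset s 1 (.lit 0)).seq (s₃ := st n n) (t₂ := t) ?_, ?_, e2 ▸ h n⟩
  · rw [← e0] at hE
    exact hE
  · have := timeUnit_ge n d
    simp only [NExpr.cost]
    omega

end Rules

/-! ### The greedy phase as a program -/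

/-!
Memory layout of the program. Registers: `0` the dimension, `1` the coordinate loop, `2` the number
`m` of steps, `3` the number `T` of Frank–Wolfe iterations, `4` the number `J` of guesses per
parameter, `5` the step, `6` the Frank–Wolfe iteration, `7` and `8` the guesses, `9` the feasibility
flag. Vectors: `0` the best candidate, `1` the input `z`, `4` and `3` the coefficients and the right
hand side of the linear constraint, `5` the current `y`, `6` a gradient, `7` the greedy weights, `8`
the last answer of the linear optimization oracle, `9` the current direction `x`, `10` its
Frank–Wolfe successor, `11` the result of the first phase, `12` the zero vector. Real variables
(entry `0` of an array): `20` `t_s`, `21` `ε`, `22` `δ`, `23` the constant factor estimate `v₀` of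
the maximum, `24` the target value, `25` its rate of growth, `26` the step size `η`, `27` and `28`
function values, `29` the Frank–Wolfe step size `γ`.
-/

/-- Entry `0` of array `a`, used as a real variable. -/
def RExpr.scalar (a : ℕ) : RExpr := .get a (.lit 0)

/-- The entry of array `a` at the index held by register `1`. -/
def RExpr.entry (a : ℕ) : RExpr := .get a (.reg 1)

/-- `m` steps of the measured greedy algorithm guided by the vector `z` in array `zArr`: for the
current vector `y`, the oracle finds `v` maximizing `⟪(1 - z - y) ⊙ ∇F y, v⟫` over `P`, and `y`
moves by `η (1 - z - y) ⊙ v`. -/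
def greedy (zArr : ℕ) : Cmd :=
  .forLoop 5 2 <|
    .seq (.callGrad 5 6) <|
    .seq (.fill 7 (.mul (.sub (.sub (.cast (.lit 1)) (.entry zArr)) (.entry 5)) (.entry 6))) <|
    .seq (.callLin 7 4 3 (.lit 0) 8 9) <|
    .fill 5 (.add (.entry 5) (.mul (.scalar 26)
      (.mul (.sub (.sub (.cast (.lit 1)) (.entry zArr)) (.entry 5)) (.entry 8))))

/-- The assumptions of the theorem on the objective function, the feasible region and the
oracles. -/
structure Problem (F : Vec n → ℝ) (G : Vec n → Vec n) (L : ℝ) (P : Set (Vec n)) (D : ℝ)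
    (lin : List (Vec n × ℝ) → Vec n → Option (Vec n)) : Prop where
  grad : NonnegWithGradient F G
  smooth : Smooth L G
  dr : DRSubmodular F
  body : DownClosedBody P
  diam : HasDiameter P D
  lin : MetaSolves P lin

section

variable {F : Vec n → ℝ} {G : Vec n → Vec n} {L D : ℝ} {P : Set (Vec n)}
  {lin : List (Vec n × ℝ) → Vec n → Option (Vec n)} {d : ℕ}

theorem MetaSolves.getD_mem (h : MetaSolves P lin) (cs : List (Vec n × ℝ)) (w : Vec n)
    {v : Vec n} (hv : v ∈ P) : (lin cs w).getD v ∈ P := by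
  cases hl : lin cs w with
  | none => exact hv
  | some x => exact ((h cs w).2 x hl).1.1

/-- Feasibility of the constraints makes the default value irrelevant. -/
theorem MetaSolves.getD_max (h : MetaSolves P lin) (cs : List (Vec n × ℝ)) (w v : Vec n)
    {o : Vec n} (ho : o ∈ P ∩ polyhedron cs) :
    (lin cs w).getD v ∈ P ∩ polyhedron cs ∧
      ∀ y ∈ P ∩ polyhedron cs, inner ℝ w y ≤ inner ℝ w ((lin cs w).getD v) := by
  cases hl : lin cs w with
  | none => exact absurd ho (by rw [(h cs w).1 hl]; exact fun h => h)
  | some x => exact (h cs w).2 x hl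

theorem polyhedron_nil : polyhedron ([] : List (Vec n × ℝ)) = Set.univ := by
  simp [polyhedron]

theorem greedy_spec (H : Problem F G L P D lin) {zArr m : ℕ} {z : Vec n} {η : ℝ} {s : State n}
    (hzArr : (greedy zArr).keepsArr zArr = true) (hn : s.reg 0 = n) (hm : s.reg 2 = m)
    (hz : s.vec zArr = z) (hzP : z ∈ cube n) (hη : s.arr 26 0 = η) (hη0 : 0 < η) (hη1 : η < 1)
    (hy : s.vec 5 = 0) (hv : s.vec 8 ∈ P) :
    Runs ⟨F, G, lin⟩ d (greedy zArr) s (m * 6 + 2) fun s' =>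
      GreedyInv F P (D ^ 2 * L) z η m (s'.vec 5) ∧ s'.vec 8 ∈ P := by
  refine Runs.forLoop (B := 4)
    (fun i s' => GreedyInv F P (D ^ 2 * L) z η i (s'.vec 5) ∧ s'.vec 8 ∈ P)
    (by decide) rfl rfl hm (fun _ _ _ h => h) ?_ ⟨hy ▸ GreedyInv.zero H.grad H.body _ _ _, hv⟩
  rintro i s' hi hf - ⟨hI, hv'⟩
  have hn' : s'.reg 0 = n := (hf.reg 0 rfl).trans hn
  have hη' : s'.arr 26 0 = η := (congrFun (hf.arr 26 rfl) 0).trans hη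
  have hz' : s'.vec zArr = z := (hf.vec zArr hzArr).trans hz
  obtain ⟨z5, z6, z7, z8⟩ : zArr ≠ 5 ∧ zArr ≠ 6 ∧ zArr ≠ 7 ∧ zArr ≠ 8 := by
    simp only [greedy, Cmd.forLoop, Cmd.fill, Cmd.keepsArr, Bool.and_eq_true] at hzArr
    simp at hzArr
    omega
  refine Runs.seq (N₁ := 1) (N₂ := 3) (Runs.callGrad ?_)
  refine Runs.seq (N₁ := 1) (N₂ := 2) (Runs.fill (x := hprod (slack z (s'.vec 5)) (G (s'.vec 5)))
    (Nat.le_of_ble_eq_true rfl) (by simpa using hn') ?_ fun k₁ => ?_)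
  · intro u t h1 _ h3 _
    simp only [RExpr.eval, RExpr.entry, NExpr.eval, h1, h3 zArr z7, h3 5 (by decide),
      h3 6 (by decide)]
    simp [z6, hz', State.arr_eq_vec]
  refine Runs.seq (N₁ := 1) (N₂ := 1) (Runs.callLin (by decide) fun k₂ => ?_)
  simp (disch := decide) only [State.constraints_zero, State.setReg_vec, State.setVec_vec_self,
    State.setVec_vec_ne]
  set w := hprod (slack z (s'.vec 5)) (G (s'.vec 5)) with hw
  set v := (lin [] w).getD (s'.vec 8)
  have hvP : v ∈ P := H.lin.getD_mem [] w hv'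
  have hmax : ∀ x ∈ P, inner ℝ w x ≤ inner ℝ w v := fun x hx => by
    have hP : P ∩ polyhedron [] = P := by rw [polyhedron_nil, Set.inter_univ]
    have := (H.lin.getD_max [] w (s'.vec 8) (o := x) (by rwa [hP])).2
    rw [hP] at this
    exact this x hx
  refine Runs.fill (x := s'.vec 5 + η • hprod (slack z (s'.vec 5)) v)
    (Nat.le_of_ble_eq_true rfl) (by simpa using hn') ?_ fun k₃ => ?_
  · intro u t h1 _ h3 h4
    simp only [RExpr.eval, RExpr.entry, RExpr.scalar, NExpr.eval, h1, h3 zArr z5, h3 26 (by decide),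
      h3 8 (by decide), h4]
    simp [z6, z7, z8, hz', hη', State.arr_eq_vec]
  · simp only [State.setReg_vec, State.setVec_vec_self]
    exact ⟨hI.step H.dr H.grad H.smooth H.body H.diam hzP hη0 hη1 hvP hmax, by simpa using hvP⟩

/-! ### The Frank–Wolfe algorithm and the second phase as programs -/

/-- `T` iterations of the Frank–Wolfe algorithm from the vector in array `9`, within the part of `P`
that satisfies the stored linear constraint. A step is only made if it gains more than `γ ε v₀`. -/
def frankWolfe : Cmd :=
  .forLoop 6 3 <|
    .seq (.callGrad 9 6) <|
    .seq (.callLin 6 4 3 (.lit 1) 8 9) <|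
    .seq (.fill 10 (.add (.entry 9) (.mul (.scalar 29) (.sub (.entry 8) (.entry 9))))) <|
    .seq (.callVal 9 27 (.lit 0)) <|
    .seq (.callVal 10 28 (.lit 0)) <|
    .ite (.rle (.scalar 28)
        (.add (.scalar 27) (.mul (.scalar 29) (.mul (.scalar 21) (.scalar 23)))))
      .nop (.fill 9 (.entry 10))

/-- One step of the second phase. The linear constraint asks for a direction `x` with
`⟪(1 - y) ⊙ ∇F y, x⟫ ≥ target - F y`; Frank–Wolfe looks for an approximate local maximum `x` among
these, `x` is emitted, and `y` moves by `η (1 - y) ⊙ x`. -/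
def hybridStep : Cmd :=
  .seq (.callGrad 5 6) <|
  .seq (.fill 4 (.mul (.sub (.entry 5) (.cast (.lit 1))) (.entry 6))) <|
  .seq (.callVal 5 27 (.lit 0)) <|
  .seq (.rset 3 (.lit 0) (.sub (.scalar 27) (.scalar 24))) <|
  .seq (.callLin 6 4 3 (.lit 1) 8 9) <|
  .seq (.fill 9 (.entry 8)) <|
  .seq frankWolfe <|
  .seq (.emit 9) <|
  .seq (.fill 5 (.add (.entry 5) (.mul (.scalar 26)
    (.mul (.sub (.cast (.lit 1)) (.entry 5)) (.entry 9))))) <|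
  .seq (.rset 24 (.lit 0) (.add (.mul (.sub (.cast (.lit 1)) (.scalar 26)) (.scalar 24))
    (.mul (.scalar 26) (.scalar 25)))) <|
  .rset 25 (.lit 0) (.mul (.sub (.cast (.lit 1)) (.scalar 26)) (.scalar 25))

/-- The second phase, for the guesses in the real variables `24` and `25`. -/
def hybrid : Cmd := .forLoop 5 2 hybridStep

/-- The Frank–Wolfe step of size `γ` from `x` gains at most `γ g`. -/
def Stuck (F : Vec n → ℝ) (G : Vec n → Vec n)
    (lin : List (Vec n × ℝ) → Vec n → Option (Vec n)) (cs : List (Vec n × ℝ)) (γ g : ℝ)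
    (x : Vec n) : Prop :=
  ∀ v, lin cs (G x) = some v → F (x + γ • (v - x)) ≤ F x + γ * g

theorem convex_polyhedron (cs : List (Vec n × ℝ)) : Convex ℝ (polyhedron cs) := by
  intro x hx y hy a b ha hb hab c hc
  rw [inner_add_right, inner_smul_right, inner_smul_right]
  have h1 := mul_le_mul_of_nonneg_left (hx c hc) ha
  have h2 := mul_le_mul_of_nonneg_left (hy c hc) hb
  calc _ ≤ a * c.2 + b * c.2 := add_le_add h1 h2
    _ = c.2 := by rw [← add_mul, hab, one_mul]

theorem step_mem {Q : Set (Vec n)} (hQ : Convex ℝ Q) {x v : Vec n} {γ : ℝ} (hx : x ∈ Q)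
    (hv : v ∈ Q) (h0 : 0 ≤ γ) (h1 : γ ≤ 1) : x + γ • (v - x) ∈ Q :=
  hQ.add_smul_sub_mem hx hv ⟨h0, h1⟩

/-- Each step that is made gains more than `γ ε v₀`, and once a step has been rejected its starting
point is never left again, because the oracle answers are the same in the next iteration. -/
theorem frankWolfe_spec (H : Problem F G L P D lin) {T : ℕ} {A : Vec n} {B γ ε v₀ : ℝ}
    {s : State n} (hn : s.reg 0 = n) (hT : s.reg 3 = T) (hA : s.vec 4 = A) (hB : s.arr 3 0 = B)
    (hγ : s.arr 29 0 = γ) (hγ0 : 0 ≤ γ) (hγ1 : γ ≤ 1) (hε : s.arr 21 0 = ε)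
    (hv₀ : s.arr 23 0 = v₀) (hv : s.vec 8 ∈ P) (hx : s.vec 9 ∈ P)
    (hxQ : (P ∩ polyhedron [(A, B)]).Nonempty → s.vec 9 ∈ P ∩ polyhedron [(A, B)]) :
    Runs ⟨F, G, lin⟩ d frankWolfe s (T * 9 + 2) fun s' =>
      s'.vec 8 ∈ P ∧ s'.vec 9 ∈ P ∧ ((P ∩ polyhedron [(A, B)]).Nonempty →
        s'.vec 9 ∈ P ∩ polyhedron [(A, B)] ∧
        (Stuck F G lin [(A, B)] γ (ε * v₀) (s'.vec 9) ∨
          T * (γ * (ε * v₀)) ≤ F (s'.vec 9))) := by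
  refine Runs.forLoop (B := 7) (fun i s' =>
      s'.vec 8 ∈ P ∧ s'.vec 9 ∈ P ∧ ((P ∩ polyhedron [(A, B)]).Nonempty →
        s'.vec 9 ∈ P ∩ polyhedron [(A, B)] ∧
        (Stuck F G lin [(A, B)] γ (ε * v₀) (s'.vec 9) ∨
          i * (γ * (ε * v₀)) ≤ F (s'.vec 9))))
    (by decide) rfl rfl hT (fun _ _ _ h => h) ?_
    ⟨hv, hx, fun h => ⟨hxQ h, Or.inr (by
      simpa using (H.grad _ (H.body.subset_cube hx)).1)⟩⟩
  rintro i s' hi hf - ⟨hv, hx, hI⟩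
  replace hn : s'.reg 0 = n := (hf.reg 0 rfl).trans hn
  replace hA : s'.vec 4 = A := (hf.vec 4 rfl).trans hA
  replace hB : s'.arr 3 0 = B := (congrFun (hf.arr 3 rfl) 0).trans hB
  replace hγ : s'.arr 29 0 = γ := (congrFun (hf.arr 29 rfl) 0).trans hγ
  replace hε : s'.arr 21 0 = ε := (congrFun (hf.arr 21 rfl) 0).trans hε
  replace hv₀ : s'.arr 23 0 = v₀ := (congrFun (hf.arr 23 rfl) 0).trans hv₀
  clear hf
  refine Runs.seq (N₁ := 1) (N₂ := 6) (Runs.callGrad ?_)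
  refine Runs.seq (N₁ := 1) (N₂ := 5) (Runs.callLin (by decide) fun k₂ => ?_)
  simp (disch := decide) only [State.constraints_one, State.setVec_vec_self,
    State.setVec_vec_ne, State.setVec_arr_ne, hA, hB]
  generalize hx₀ : s'.vec 9 = x at *
  set v := (lin [(A, B)] (G x)).getD (s'.vec 8) with hv'
  have hvP : v ∈ P := H.lin.getD_mem _ _ hv
  refine Runs.seq (N₁ := 1) (N₂ := 4) (Runs.fill (x := x + γ • (v - x))
    (by decide) (by simpa using hn) ?_ fun k₃ => ?_)
  · intro u t h1 _ h3 _
    simp only [RExpr.eval, RExpr.entry, RExpr.scalar, NExpr.eval, h1, h3 29 (by decide),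
      h3 8 (by decide), h3 9 (by decide)]
    simp [hγ, hx₀, State.arr_eq_vec]
  refine Runs.seq (N₁ := 1) (N₂ := 3) (Runs.callVal ?_)
  refine Runs.seq (N₁ := 1) (N₂ := 2) (Runs.callVal ?_)
  refine Runs.ite (N := 1) (by decide) (fun hb => Runs.nop ?_) (fun hb => Runs.fill
    (x := x + γ • (v - x)) (by decide) (by simpa using hn) ?_ fun k₄ => ?_)
  · simp only [BExpr.holds, RExpr.eval, RExpr.scalar, NExpr.eval] at hb
    simp [hγ, hε, hv₀, hx₀] at hb
    simp [hx₀]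
    refine ⟨hvP, hx, fun hne => ⟨(hI hne).1, Or.inl fun v' h => ?_⟩⟩
    have : v' = v := by rw [hv', h]; rfl
    rw [this]
    exact hb
  · intro u t h1 _ h3 _
    simp only [RExpr.eval, RExpr.entry, NExpr.eval, h1, h3 10 (by decide)]
    simp
  · simp only [BExpr.holds, RExpr.eval, RExpr.scalar, NExpr.eval] at hb
    simp [hγ, hε, hv₀, hx₀] at hb
    simp
    refine ⟨hvP, step_mem H.body.convex hx hvP hγ0 hγ1, fun hne => ?_⟩
    obtain ⟨hxQ, hI⟩ := hI hne
    obtain ⟨hvQ, -⟩ := H.lin.getD_max _ (G x) (s'.vec 8) hxQ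
    refine ⟨step_mem (H.body.convex.inter (convex_polyhedron _)) hxQ hvQ hγ0 hγ1, Or.inr ?_⟩
    rcases hI with hI | hI
    · cases hl : lin [(A, B)] (G x) with
      | none => exact absurd hxQ (by rw [(H.lin _ _).1 hl]; exact fun h => h)
      | some v' =>
        have : v' = v := by rw [hv', hl]; rfl
        have := hI v' hl
        subst_vars
        linarith
    · linarith

/-- A point of `P` that maximizes `F` over `P` and for which the second phase succeeds when it is
started at `y₀` with the guesses `a` and `b`. -/
structure Comparable (F : Vec n → ℝ) (P : Set (Vec n)) (z y₀ : Vec n) (ε ρ g M a b : ℝ)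
    (o : Vec n) : Prop where
  mem : o ∈ P
  max : ∀ x ∈ P, F x ≤ F o
  lt : F o < M
  gain_le : g ≤ ε * F o
  a_le : a ≤ F (psum y₀ o)
  b_le : b ≤ Max.max 0 (ρ * (F (psum z o) - ε * F o))

/-- State of the second phase after `k` steps. For every comparison point, either one of the vectors
emitted so far is a damaging local maximum, or the lower bounds still hold. -/
structure HybridState (F : Vec n → ℝ) (P : Set (Vec n)) (L D : ℝ) (z y₀ : Vec n)
    (τ ρ η ε δ g M a b : ℝ) (out : List (Vec n)) (k : ℕ) (s : State n) : Prop where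
  inv : HybridInv P τ ρ η k (s.vec 5)
  target_eq : s.arr 24 0 = target η a b k
  rate_eq : s.arr 25 0 = (1 - η) ^ k * b
  lin_mem : s.vec 8 ∈ P
  out : ∃ new, s.out = out ++ new ∧ new.length = k ∧ (∀ x ∈ new, x ∈ P) ∧
    ∀ o, Comparable F P z y₀ ε ρ g M a b o →
      (∃ x ∈ new, DamagingLocalMax 1000 ε δ L D F z o x) ∨
      HybridValue F (D ^ 2 * L) η a b (F y₀) o k (s.vec 5)

/-- While the lower bounds hold for `o`, the point `o` satisfies the linear constraint. Hence the
region searched by Frank–Wolfe is not empty, and its result is an approximate local maximum with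
respect to `o`: it is damaging or keeps the lower bounds intact. -/
theorem hybridStep_spec (H : Problem F G L P D lin) {T k : ℕ} {z y₀ : Vec n}
    {τ ρ η ε δ γ v₀ a b : ℝ} {out : List (Vec n)} {s : State n}
    (hn : s.reg 0 = n) (hT : s.reg 3 = T) (hη : s.arr 26 0 = η) (hη0 : 0 < η) (hη1 : η < 1)
    (hγ : s.arr 29 0 = γ) (hγ0 : 0 < γ) (hγ1 : γ ≤ 1) (hγδ : γ ≤ δ) (hε : s.arr 21 0 = ε)
    (hε0 : 0 < ε) (hv₀ : s.arr 23 0 = v₀) (hτ : 0 ≤ τ) (hρ0 : 0 ≤ ρ) (hρ1 : ρ ≤ 1)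
    (hs : HybridState F P L D z y₀ τ ρ η ε δ (ε * v₀) (T * (γ * (ε * v₀))) a b out k s) :
    Runs ⟨F, G, lin⟩ d hybridStep s (T * 9 + 12)
      (HybridState F P L D z y₀ τ ρ η ε δ (ε * v₀) (T * (γ * (ε * v₀))) a b out (k + 1)) := by
  obtain ⟨hinv, htgt, hrate, hv, new, hout, hlen, hnew, hval⟩ := hs
  have hyc := hinv.mem_cube hρ0 hη1
  generalize hy : s.vec 5 = y at *
  refine Runs.mono (N := 1 + (1 + (1 + (1 + (1 + (1 + ((T * 9 + 2) + (1 + (1 + (1 + 1))))))))))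
    ?_ (by omega) fun _ _ h => h
  refine Runs.seq (Runs.callGrad ?_)
  refine Runs.seq (Runs.fill (x := -hprod (slack 0 y) (G y)) (by decide) (by simpa using hn) ?_
    fun k₁ => ?_)
  · intro u t h1 _ h3 _
    simp only [RExpr.eval, RExpr.entry, NExpr.eval, h1, h3 5 (by decide), h3 6 (by decide)]
    simp [hy, State.arr_eq_vec]
    ring
  refine Runs.seq (Runs.callVal ?_)
  refine Runs.seq (Runs.rset (by decide) ?_)
  refine Runs.seq (Runs.callLin (by decide) fun k₂ => ?_)
  simp (disch := decide) only [State.constraints_one, State.setVec_vec_self, State.setReg_vec,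
    State.setVec_vec_ne, State.setVec_arr_ne, State.setEntry_vec_ne, State.setEntry_arr_ne,
    State.setEntry_arr_self, State.setReg_arr, RExpr.eval, RExpr.scalar, NExpr.eval, hy, htgt]
  generalize hQ : ([(-hprod (slack 0 y) (G y), F y - target η a b k)] : List (Vec n × ℝ)) = cs
  have hvP := H.lin.getD_mem cs (G y) hv
  have hvQ : (P ∩ polyhedron cs).Nonempty →
      (lin cs (G y)).getD (s.vec 8) ∈ P ∩ polyhedron cs := fun ⟨o, ho⟩ =>
    (H.lin.getD_max cs (G y) (s.vec 8) ho).1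
  generalize (lin cs (G y)).getD (s.vec 8) = v at *
  refine Runs.seq (Runs.fill (x := v) (by decide) (by simpa using hn) ?_ fun k₃ => ?_)
  · intro u t h1 _ h3 _
    simp only [RExpr.eval, RExpr.entry, NExpr.eval, h1, h3 8 (by decide)]
    simp
  refine Runs.seq ((frankWolfe_spec H (T := T) (A := -hprod (slack 0 y) (G y))
    (B := F y - target η a b k) (γ := γ) (ε := ε) (v₀ := v₀) (by simpa using hn)
    (by simpa using hT) (by simp) (by simp) (by simpa using hγ) hγ0.le hγ1 (by simpa using hε)
    (by simpa using hv₀) (by simpa using hvP) (by simpa using hvP)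
    (by simpa [hQ] using hvQ)).mono le_rfl fun s₁ hf h => ?_)
  rw [hQ] at h
  obtain ⟨hv₁, hxP, hx⟩ := h
  have hn₁ : s₁.reg 0 = n := (hf.reg 0 rfl).trans (by simpa using hn)
  have hy₁ : s₁.vec 5 = y := (hf.vec 5 rfl).trans (by simpa using hy)
  have hη₁ : s₁.arr 26 0 = η := (congrFun (hf.arr 26 rfl) 0).trans (by simpa using hη)
  have htgt₁ : s₁.arr 24 0 = target η a b k :=
    (congrFun (hf.arr 24 rfl) 0).trans (by simpa using htgt)
  have hrate₁ : s₁.arr 25 0 = (1 - η) ^ k * b :=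
    (congrFun (hf.arr 25 rfl) 0).trans (by simpa using hrate)
  have hout₁ : s₁.out = out ++ new := (hf.out rfl).trans (by simpa using hout)
  clear hf
  generalize hx₁ : s₁.vec 9 = x at *
  refine Runs.seq (Runs.emit ?_)
  refine Runs.seq (Runs.fill (x := y + η • hprod (slack 0 y) x) (by decide) (by exact hn₁) ?_
    fun k₄ => ?_)
  · intro u t h1 _ h3 h4
    simp only [RExpr.eval, RExpr.entry, NExpr.eval, h1, h3 26 (by decide), h3 9 (by decide), h4]
    have e1 : s₁.arr 5 u = y u := by rw [State.arr_eq_vec, hy₁]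
    have e2 : s₁.arr 9 u = x u := by rw [State.arr_eq_vec, hx₁]
    simp [e1, e2, hη₁]
  refine Runs.seq (Runs.rset (by decide) (Runs.rset (by decide) ?_))
  have hsame : ∀ a, State.vec { s₁ with out := s₁.out ++ [s₁.vec 9] } a = s₁.vec a :=
    fun _ => rfl
  constructor
  · simpa using hinv.step H.body hτ hρ0 hη0 hη1 hxP
  · simp [RExpr.eval, NExpr.eval, hη₁, htgt₁, hrate₁, target_succ hη1]
  · simp [RExpr.eval, NExpr.eval, hη₁, hrate₁, pow_succ]
    ring
  · simpa [hsame] using hv₁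
  · refine ⟨new ++ [x], by simp [hout₁, hx₁], by simp [hlen], ?_, ?_⟩
    · simp only [List.mem_append, List.mem_singleton]
      rintro x' (h | rfl)
      · exact hnew x' h
      · exact hxP
    intro o ho
    simp (disch := decide) only [State.setEntry_vec_ne, State.setReg_vec, State.setVec_vec_self]
    rcases hval o ho with ⟨x', hx', hd⟩ | hvo
    · exact Or.inl ⟨x', by simp [hx'], hd⟩
    have hoc := H.body.subset_cube ho.mem
    have hoQ : o ∈ P ∩ polyhedron cs := by
      refine ⟨ho.mem, ?_⟩
      have := hvo.le_inner H.dr H.grad hyc hoc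
      simp only [← hQ, polyhedron, List.mem_singleton, forall_eq, Set.mem_ofPred_eq,
        inner_neg_left]
      linarith
    obtain ⟨hxQ, hstuck⟩ := hx ⟨o, hoQ⟩
    have hFo : 0 ≤ F o := (H.grad o hoc).1
    by_cases hdam : F (psum x o) ≤ F (psum z o) - ε * F o
    · refine Or.inl ⟨x, by simp, hdam, ?_⟩
      have hst : Stuck F G lin cs γ (ε * v₀) x := by
        rcases hstuck with h | h
        · exact h
        · linarith [ho.lt, ho.max x hxP]
      cases hl : lin cs (G x) with
      | none => exact absurd hoQ (by rw [(H.lin _ _).1 hl]; exact fun h => h)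
      | some v' =>
        obtain ⟨hv'Q, hv'max⟩ := (H.lin _ _).2 v' hl
        have := local_max_of_small_gain H.dr H.grad H.smooth H.body H.diam hxP hv'Q.1 ho.mem hγ0
          hγ1 (hv'max o hoQ) (hst v' hl)
        have h1 := ho.gain_le
        have hS : 0 ≤ D ^ 2 * L := mul_nonneg (sq_nonneg _) H.smooth.1
        have h2 : γ * (D ^ 2 * L) ≤ δ * (D ^ 2 * L) := by gcongr
        have h3 : 0 ≤ γ * (D ^ 2 * L) := by positivity
        have h4 : 0 ≤ ε * F o := by positivity
        have h5 : δ * D ^ 2 * L = δ * (D ^ 2 * L) := by ring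
        rw [h5]
        linarith
    · refine Or.inr (hvo.step H.dr H.grad H.smooth H.body H.diam hτ hρ0 hρ1 hη0 hη1 ho.mem hinv
        hxP ?_ ?_)
      · refine ho.b_le.trans (max_le ?_ ?_)
        · exact mul_nonneg hρ0 (H.grad _ (psum_mem_cube (H.body.subset_cube hxP) hoc)).1
        · exact mul_le_mul_of_nonneg_left (not_le.1 hdam).le hρ0
      · have := hxQ.2
        simp only [← hQ, polyhedron, List.mem_singleton, forall_eq, Set.mem_ofPred_eq,
          inner_neg_left] at this
        linarith

theorem hybrid_spec (H : Problem F G L P D lin) {T m : ℕ} {z y₀ : Vec n}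
    {τ ρ η ε δ γ v₀ a b : ℝ} {out : List (Vec n)} {s : State n}
    (hn : s.reg 0 = n) (hm : s.reg 2 = m) (hT : s.reg 3 = T) (hη : s.arr 26 0 = η) (hη0 : 0 < η)
    (hη1 : η < 1) (hγ : s.arr 29 0 = γ) (hγ0 : 0 < γ) (hγ1 : γ ≤ 1) (hγδ : γ ≤ δ)
    (hε : s.arr 21 0 = ε) (hε0 : 0 < ε) (hv₀ : s.arr 23 0 = v₀) (hτ : 0 ≤ τ)
    (hρ0 : 0 ≤ ρ) (hρ1 : ρ ≤ 1)
    (hs : HybridState F P L D z y₀ τ ρ η ε δ (ε * v₀) (T * (γ * (ε * v₀))) a b out 0 s) :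
    Runs ⟨F, G, lin⟩ d hybrid s (m * (T * 9 + 14) + 2)
      (HybridState F P L D z y₀ τ ρ η ε δ (ε * v₀) (T * (γ * (ε * v₀))) a b out m) := by
  refine Runs.forLoop (HybridState F P L D z y₀ τ ρ η ε δ (ε * v₀) (T * (γ * (ε * v₀))) a b out)
    (by decide) rfl rfl hm (fun _ _ _ h => ⟨h.1, h.2, h.3, h.4, h.5⟩) ?_ hs
  intro i s' hi hf _ hs'
  exact hybridStep_spec H ((hf.reg 0 rfl).trans hn) ((hf.reg 3 rfl).trans hT)
    ((congrFun (hf.arr 26 rfl) 0).trans hη) hη0 hη1 ((congrFun (hf.arr 29 rfl) 0).trans hγ) hγ0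
    hγ1 hγδ ((congrFun (hf.arr 21 rfl) 0).trans hε) hε0
    ((congrFun (hf.arr 23 rfl) 0).trans hv₀) hτ hρ0 hρ1 hs'

/-! ### The search over the guesses -/

/-- Run the second phase for the guesses `a = i ε v₀` and `b = j ε v₀`, where registers `7` and `8`
hold `i` and `j`, and keep the result if it is better than the best candidate so far. -/
def tryGuess : Cmd :=
  .seq (.fill 5 (.entry 11)) <|
  .seq (.rset 24 (.lit 0) (.mul (.cast (.reg 7)) (.mul (.scalar 21) (.scalar 23)))) <|
  .seq (.rset 25 (.lit 0) (.mul (.cast (.reg 8)) (.mul (.scalar 21) (.scalar 23)))) <|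
  .seq hybrid <|
  .seq (.callVal 5 27 (.lit 0)) <|
  .seq (.callVal 0 28 (.lit 0)) <|
  .ite (.rle (.scalar 28) (.scalar 27)) (.fill 0 (.entry 5)) .nop

/-- Try all pairs of guesses `i, j < J`. -/
def search : Cmd := .forLoop 7 4 (.forLoop 8 4 tryGuess)

/-- What the registers and arrays hold during the search. -/
structure Ready (m T J : ℕ) (ε v₀ η : ℝ) (y₀ : Vec n)
    (s : State n) : Prop where
  n_eq : s.reg 0 = n
  m_eq : s.reg 2 = m
  T_eq : s.reg 3 = T
  J_eq : s.reg 4 = J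
  ε_eq : s.arr 21 0 = ε
  v₀_eq : s.arr 23 0 = v₀
  η_eq : s.arr 26 0 = η
  γ_eq : s.arr 29 0 = 1 / (m : ℝ)
  y₀_eq : s.vec 11 = y₀

theorem Ready.frame {m T J : ℕ} {ε v₀ η : ℝ} {y₀ : Vec n} {s s' : State n} {c : Cmd}
    (h : Ready m T J ε v₀ η y₀ s) (hf : Frame c s s')
    (hreg : [0, 2, 3, 4].all (fun v => c.keepsReg v) = true)
    (harr : [11, 21, 23, 26, 29].all (fun a => c.keepsArr a) = true) :
    Ready m T J ε v₀ η y₀ s' := by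
  simp only [List.all_cons, List.all_nil, Bool.and_eq_true, and_true] at hreg harr
  obtain ⟨r0, r2, r3, r4⟩ := hreg
  obtain ⟨a11, a21, a23, a26, a29⟩ := harr
  exact ⟨(hf.reg 0 r0).trans h.n_eq, (hf.reg 2 r2).trans h.m_eq, (hf.reg 3 r3).trans h.T_eq,
    (hf.reg 4 r4).trans h.J_eq, (congrFun (hf.arr 21 a21) 0).trans h.ε_eq,
    (congrFun (hf.arr 23 a23) 0).trans h.v₀_eq, (congrFun (hf.arr 26 a26) 0).trans h.η_eq,
    (congrFun (hf.arr 29 a29) 0).trans h.γ_eq, (hf.vec 11 a11).trans h.y₀_eq⟩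

/-- State of the search after all guesses `(i', j')` that precede `(i, j)` lexicographically. -/
structure SearchState (F : Vec n → ℝ) (P : Set (Vec n)) (L D : ℝ) (z y₀ : Vec n)
    (ρ η ε δ g M : ℝ) (m J i j : ℕ) (s : State n) : Prop where
  best_mem : s.vec 0 ∈ P
  lin_mem : s.vec 8 ∈ P
  length : s.out.length = (i * J + j) * m
  out_mem : ∀ x ∈ s.out, x ∈ P
  found : ∀ i' j' : ℕ, (i' < i ∧ j' < J ∨ i' = i ∧ j' < j) → ∀ o,
    Comparable F P z y₀ ε ρ g M (i' * g) (j' * g) o →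
    (∃ x ∈ s.out, DamagingLocalMax 1000 ε δ L D F z o x) ∨
    progress η (D ^ 2 * L) (i' * g) (j' * g) (F y₀) m ≤ F (s.vec 0)

theorem tryGuess_spec (H : Problem F G L P D lin) {m T J i j : ℕ} {z y₀ : Vec n}
    {τ ρ η ε δ v₀ : ℝ} {s : State n} (hr : Ready m T J ε v₀ η y₀ s) (hi : s.reg 7 = i)
    (hj : s.reg 8 = j) (hη0 : 0 < η) (hη1 : η < 1) (hm : 1 ≤ m) (hmδ : 1 / (m : ℝ) ≤ δ)
    (hε0 : 0 < ε) (hτ : 0 ≤ τ) (hτm : τ + m * η ≤ 1) (hρ0 : 0 ≤ ρ) (hρ1 : ρ ≤ 1)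
    (hy₀ : HybridInv P τ ρ η 0 y₀)
    (hs : SearchState F P L D z y₀ ρ η ε δ (ε * v₀) (T * (1 / m * (ε * v₀))) m J i j s) :
    Runs ⟨F, G, lin⟩ d tryGuess s (m * (T * 9 + 14) + 9)
      (SearchState F P L D z y₀ ρ η ε δ (ε * v₀) (T * (1 / m * (ε * v₀))) m J i (j + 1)) := by
  have hm' : (1 : ℝ) ≤ m := by exact_mod_cast hm
  refine Runs.mono (N := 1 + (1 + (1 + ((m * (T * 9 + 14) + 2) + (1 + (1 + (1 + 1)))))))
    ?_ (by omega) fun _ _ h => h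
  refine Runs.seq (Runs.fill (x := y₀) (by decide) hr.n_eq ?_ fun k₁ => ?_)
  · intro u t h1 _ h3 _
    simp only [RExpr.eval, RExpr.entry, NExpr.eval, h1, h3 11 (by decide)]
    rw [State.arr_eq_vec, hr.y₀_eq]
  refine Runs.seq (Runs.rset (by decide) ?_)
  refine Runs.seq (Runs.rset (by decide) ?_)
  refine Runs.seq ((hybrid_spec H (T := T) (m := m) (z := z) (y₀ := y₀) (τ := τ) (ρ := ρ)
    (η := η) (ε := ε) (δ := δ) (γ := 1 / m) (v₀ := v₀) (a := i * (ε * v₀)) (b := j * (ε * v₀))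
    (out := s.out) (by simpa using hr.n_eq) (by simpa using hr.m_eq) (by simpa using hr.T_eq)
    (by simpa using hr.η_eq) hη0 hη1 (by simpa using hr.γ_eq) (by positivity)
    (by rw [div_le_one (by linarith)]; exact hm') hmδ (by simpa using hr.ε_eq) hε0
    (by simpa using hr.v₀_eq) hτ hρ0 hρ1 ?_).mono le_rfl fun s₁ hf h => ?_)
  · refine ⟨by simpa using hy₀, ?_, ?_, by simpa using hs.lin_mem, [], by simp, rfl, by simp, ?_⟩
    · simp [RExpr.eval, RExpr.scalar, NExpr.eval, hi, hr.ε_eq, hr.v₀_eq, target]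
    · simp [RExpr.eval, RExpr.scalar, NExpr.eval, hj, hr.ε_eq, hr.v₀_eq]
    · intro o ho
      refine Or.inr ⟨?_, ?_⟩
      · simpa [target] using ho.a_le
      · simp [progress]
  have hn₁ : s₁.reg 0 = n := (hf.reg 0 rfl).trans (by simpa using hr.n_eq)
  have hbest : s₁.vec 0 = s.vec 0 := (hf.vec 0 rfl).trans (by simp)
  clear hf
  obtain ⟨hinv, -, -, hv, new, hout, hlen, hnew, hval⟩ := h
  have hyP : s₁.vec 5 ∈ P := hinv.scaled.mem H.body hτm hinv.nonneg
  -- Both branches end with a vector that is at least as good as the old and the new candidate.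
  have key : ∀ s₂ : State n, s₂.out = s₁.out → s₂.vec 8 = s₁.vec 8 → s₂.vec 0 ∈ P →
      F (s.vec 0) ≤ F (s₂.vec 0) → F (s₁.vec 5) ≤ F (s₂.vec 0) →
      SearchState F P L D z y₀ ρ η ε δ (ε * v₀) (T * (1 / m * (ε * v₀))) m J i (j + 1) s₂ := by
    intro s₂ h1 h2 h3 h4 h5
    refine ⟨h3, h2 ▸ hv, ?_, ?_, ?_⟩
    · rw [h1, hout, List.length_append, hs.length, hlen]
      ring
    · rw [h1, hout]
      intro x hx
      rcases List.mem_append.1 hx with hx | hx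
      · exact hs.out_mem x hx
      · exact hnew x hx
    · intro i' j' hij o ho
      rw [h1, hout]
      by_cases hlast : i' = i ∧ j' = j
      · obtain ⟨rfl, rfl⟩ := hlast
        rcases hval o ho with ⟨x, hx, hd⟩ | h
        · exact Or.inl ⟨x, List.mem_append_right _ hx, hd⟩
        · exact Or.inr (h.progress_le.trans h5)
      · rcases hs.found i' j' (by omega) o ho with ⟨x, hx, hd⟩ | h
        · exact Or.inl ⟨x, List.mem_append_left _ hx, hd⟩
        · exact Or.inr (h.trans h4)
  refine Runs.seq (Runs.callVal ?_)
  refine Runs.seq (Runs.callVal ?_)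
  refine Runs.ite (N := 1) (by decide) (fun hb => Runs.fill (x := s₁.vec 5) (by decide)
    (by simpa using hn₁) ?_ fun k => ?_) (fun hb => Runs.nop ?_)
  · intro u t h1 _ h3 _
    simp only [RExpr.eval, RExpr.entry, NExpr.eval, h1, h3 5 (by decide)]
    simp [State.arr_eq_vec]
  · simp [BExpr.holds, RExpr.eval, RExpr.scalar, NExpr.eval, hbest] at hb
    exact key _ (by simp) (by simp) (by simpa using hyP) (by simpa using hb) (by simp)
  · simp [BExpr.holds, RExpr.eval, RExpr.scalar, NExpr.eval, hbest] at hb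
    exact key _ (by simp) (by simp) (by simpa [hbest] using hs.best_mem) (by simp [hbest])
      (by simpa [hbest] using hb.le)

theorem search_spec (H : Problem F G L P D lin) {m T J : ℕ} {z y₀ : Vec n}
    {τ ρ η ε δ v₀ : ℝ} {s : State n} (hr : Ready m T J ε v₀ η y₀ s) (hη0 : 0 < η)
    (hη1 : η < 1) (hm : 1 ≤ m) (hmδ : 1 / (m : ℝ) ≤ δ)
    (hε0 : 0 < ε) (hτ : 0 ≤ τ) (hτm : τ + m * η ≤ 1) (hρ0 : 0 ≤ ρ) (hρ1 : ρ ≤ 1)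
    (hy₀ : HybridInv P τ ρ η 0 y₀) (hbest : s.vec 0 ∈ P) (hv : s.vec 8 ∈ P) (hout : s.out = []) :
    Runs ⟨F, G, lin⟩ d search s (J * (J * (m * (T * 9 + 14) + 11) + 4) + 2)
      (SearchState F P L D z y₀ ρ η ε δ (ε * v₀) (T * (1 / m * (ε * v₀))) m J J 0) := by
  refine Runs.forLoop (B := J * (m * (T * 9 + 14) + 11) + 2)
    (fun i => SearchState F P L D z y₀ ρ η ε δ (ε * v₀) (T * (1 / m * (ε * v₀))) m J i 0)
    (by decide) rfl rfl hr.J_eq (fun _ _ _ h => ⟨h.1, h.2, h.3, h.4, h.5⟩) ?_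
    ⟨hbest, hv, by simp [hout], by simp [hout], fun i' j' h => by omega⟩
  intro i s₁ hi hf₁ hreg₁ hI
  have hr₁ := hr.frame hf₁ rfl rfl
  refine (Runs.forLoop (B := m * (T * 9 + 14) + 9)
    (fun j => SearchState F P L D z y₀ ρ η ε δ (ε * v₀) (T * (1 / m * (ε * v₀))) m J i j)
    (by decide) rfl rfl hr₁.J_eq (fun _ _ _ h => ⟨h.1, h.2, h.3, h.4, h.5⟩) ?_ hI).mono le_rfl
    fun s' _ h => ⟨h.1, h.2, by rw [h.3]; ring, h.4, fun i' j' hij => h.5 i' j' (by omega)⟩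
  intro j s₂ hj hf₂ hreg₂ hI₂
  exact tryGuess_spec H (hr₁.frame hf₂ rfl rfl) ((hf₂.reg 7 rfl).trans hreg₁) hreg₂ hη0 hη1 hm hmδ
    hε0 hτ hτm hρ0 hρ1 hy₀ hI₂

/-- Clear the output vector, compute `m`, `T` and `J`, estimate the maximum by half a unit of time
of the greedy phase with `0` in place of `z`, and run the first phase for time `t_s`. As the estimate
`v₀` satisfies `F o ≤ 8 v₀`, at most `8 m / ε` Frank–Wolfe steps can gain `ε v₀ / m` each, and the
guessed values, which are at most `2 F o ≤ 16 v₀`, are at most `16 / ε` multiples of `ε v₀`; `9` and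
`17` exceed these constants. -/
def setup : Cmd :=
  .seq (.rset 20 (.lit 0) (.get 0 (.lit 0))) <|
  .seq (.rset 21 (.lit 0) (.get 0 (.lit 1))) <|
  .seq (.rset 22 (.lit 0) (.get 0 (.lit 2))) <|
  .seq (.fill 0 (.cast (.lit 0))) <|
  .seq (.count 2 (.and (.rle (.cast (.lit 1)) (.mul (.cast (.reg 2)) (.scalar 22)))
    (.rle (.cast (.lit 1)) (.mul (.cast (.reg 2)) (.scalar 21))))) <|
  .seq (.count 3 (.rle (.mul (.cast (.lit 9)) (.cast (.reg 2)))
    (.mul (.cast (.reg 3)) (.scalar 21)))) <|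
  .seq (.count 4 (.rle (.cast (.lit 17)) (.mul (.cast (.reg 4)) (.scalar 21)))) <|
  .seq (.rset 29 (.lit 0) (.div (.cast (.lit 1)) (.cast (.reg 2)))) <|
  .seq (.rset 26 (.lit 0) (.div (.div (.cast (.lit 1)) (.cast (.lit 2))) (.cast (.reg 2)))) <|
  .seq (greedy 12) <|
  .seq (.callVal 5 23 (.lit 0)) <|
  .seq (.fill 5 (.cast (.lit 0))) <|
  .seq (.rset 26 (.lit 0) (.div (.scalar 20) (.cast (.reg 2)))) <|
  .seq (greedy 1) <|
  .seq (.fill 11 (.entry 5)) <|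
  .rset 26 (.lit 0) (.div (.sub (.cast (.lit 1)) (.scalar 20)) (.cast (.reg 2)))

theorem setup_spec (H : Problem F G L P D lin) {ts ε δ : ℝ} {z : Vec n} (hz : z ∈ P)
    (hts0 : 0 < ts) (hts1 : ts < 1) {m T J : ℕ} (hm2 : 2 ≤ m)
    (hm : 1 ≤ m * δ ∧ 1 ≤ m * ε) (hm' : ∀ k < m, ¬ (1 ≤ k * δ ∧ 1 ≤ k * ε))
    (hT : 9 * m ≤ T * ε) (hT' : ∀ k < T, ¬ (9 * m ≤ k * ε))
    (hJ : 17 ≤ J * ε) (hJ' : ∀ k < J, ¬ (17 ≤ k * ε)) :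
    Runs ⟨F, G, lin⟩ d setup (inputState ts ε δ z) (m * 14 + T * 2 + J * 2 + 18) fun s =>
      ∃ y' y₀, GreedyInv F P (D ^ 2 * L) 0 (1 / 2 / m) m y' ∧
        GreedyInv F P (D ^ 2 * L) z (ts / m) m y₀ ∧
        Ready m T J ε (F y') ((1 - ts) / m) y₀ s ∧
        s.vec 0 ∈ P ∧ s.vec 8 ∈ P ∧ s.out = [] := by
  have hm0 : (2 : ℝ) ≤ m := by exact_mod_cast hm2
  refine Runs.mono (N := 1 + (1 + (1 + (1 + ((m * 2 + 1) + ((T * 2 + 1) + ((J * 2 + 1) + (1 + (1 +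
    ((m * 6 + 2) + (1 + (1 + (1 + ((m * 6 + 2) + (1 + 1)))))))))))))))
    ?_ (by omega) fun _ _ h => h
  have hn₀ : (inputState ts ε δ z).reg 0 = n := rfl
  have hr₀ : ∀ v, v ≠ 0 → (inputState ts ε δ z).reg v = 0 := fun v hv => by simp [inputState, hv]
  have ha₀ : (inputState ts ε δ z).arr 0 0 = ts ∧ (inputState ts ε δ z).arr 0 1 = ε ∧
      (inputState ts ε δ z).arr 0 2 = δ := by simp [inputState]
  have hz₀ : (inputState ts ε δ z).vec 1 = z := by
    ext u
    simp [inputState, State.vec]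
  have hv₀ : ∀ a, 2 ≤ a → (inputState ts ε δ z).vec a = 0 := fun a ha => by
    have h0 : a ≠ 0 := by omega
    have h1 : a ≠ 1 := by omega
    ext u
    simp [inputState, State.vec, h0, h1]
  have hout₀ : (inputState ts ε δ z).out = [] := rfl
  generalize inputState ts ε δ z = s at *
  obtain ⟨ha0, ha1, ha2⟩ := ha₀
  refine Runs.seq (Runs.rset (by decide) ?_)
  refine Runs.seq (Runs.rset (by decide) ?_)
  refine Runs.seq (Runs.rset (by decide) ?_)
  simp (disch := decide) only [RExpr.eval, NExpr.eval, State.setEntry_arr_ne, ha0, ha1, ha2]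
  refine Runs.seq (Runs.fill (x := 0) (by decide) (by simpa using hn₀)
    (fun u t _ _ _ _ => by simp [RExpr.eval, NExpr.eval]) fun k₁ => ?_)
  refine Runs.seq (Runs.count (p := fun k => 1 ≤ k * δ ∧ 1 ≤ k * ε) (by decide) (fun k => by
    simp [BExpr.holds, RExpr.eval, RExpr.scalar, NExpr.eval]) (by simpa using hr₀ 2 (by decide))
    hm hm' ?_)
  refine Runs.seq (Runs.count (p := fun k => 9 * m ≤ k * ε) (by decide) (fun k => by
    simp [BExpr.holds, RExpr.eval, RExpr.scalar, NExpr.eval]) (by simpa using hr₀ 3 (by decide))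
    hT hT' ?_)
  refine Runs.seq (Runs.count (p := fun k => 17 ≤ k * ε) (by decide) (fun k => by
    simp [BExpr.holds, RExpr.eval, RExpr.scalar, NExpr.eval]) (by simpa using hr₀ 4 (by decide))
    hJ hJ' ?_)
  refine Runs.seq (Runs.rset (by decide) ?_)
  refine Runs.seq (Runs.rset (by decide) ?_)
  refine Runs.seq ((greedy_spec H (m := m) (z := 0) (η := 1 / 2 / m) rfl (by simpa using hn₀)
    (by simp) (by simpa using hv₀ 12 (by decide)) zero_mem_cube
    (by simp [RExpr.eval, NExpr.eval]) (by positivity)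
    (by rw [div_lt_one (by linarith)]; linarith)
    (by simpa using hv₀ 5 (by decide))
    (by simpa [hv₀ 8 (by decide)] using H.body.zero_mem)).mono le_rfl fun s₁ hf h => ?_)
  have hn₁ : s₁.reg 0 = n := (hf.reg 0 rfl).trans (by simpa using hn₀)
  have hm₁ : s₁.reg 2 = m := (hf.reg 2 rfl).trans (by simp)
  have hT₁ : s₁.reg 3 = T := (hf.reg 3 rfl).trans (by simp)
  have hJ₁ : s₁.reg 4 = J := (hf.reg 4 rfl).trans (by simp)
  have hts₁ : s₁.arr 20 0 = ts := (congrFun (hf.arr 20 rfl) 0).trans (by simp)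
  have hε₁ : s₁.arr 21 0 = ε := (congrFun (hf.arr 21 rfl) 0).trans (by simp)
  have hγ₁ : s₁.arr 29 0 = 1 / (m : ℝ) :=
    (congrFun (hf.arr 29 rfl) 0).trans (by simp [RExpr.eval, NExpr.eval])
  have hb₁ : s₁.vec 0 = 0 := (hf.vec 0 rfl).trans (by simp)
  have hz₁ : s₁.vec 1 = z := (hf.vec 1 rfl).trans (by simpa using hz₀)
  have hout₁ : s₁.out = [] := (hf.out rfl).trans (by simpa using hout₀)
  clear hf
  obtain ⟨hy', hv₁⟩ := h
  generalize hy₁ : s₁.vec 5 = y' at *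
  refine Runs.seq (Runs.callVal ?_)
  refine Runs.seq (Runs.fill (x := 0) (by decide) (by simpa using hn₁)
    (fun u t _ _ _ _ => by simp [RExpr.eval, NExpr.eval]) fun k₂ => ?_)
  refine Runs.seq (Runs.rset (by decide) ?_)
  refine Runs.seq ((greedy_spec H (m := m) (z := z) (η := ts / m) rfl (by simpa using hn₁)
    (by simpa using hm₁) (by simpa using hz₁) (H.body.subset_cube hz)
    (by simp [RExpr.eval, RExpr.scalar, NExpr.eval, hts₁, hm₁]) (by positivity)
    (by rw [div_lt_one (by linarith)]; linarith)
    (by simp) (by simpa using hv₁)).mono le_rfl fun s₂ hf h => ?_)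
  have hn₂ : s₂.reg 0 = n := (hf.reg 0 rfl).trans (by simpa using hn₁)
  have hm₂ : s₂.reg 2 = m := (hf.reg 2 rfl).trans (by simpa using hm₁)
  have hT₂ : s₂.reg 3 = T := (hf.reg 3 rfl).trans (by simpa using hT₁)
  have hJ₂ : s₂.reg 4 = J := (hf.reg 4 rfl).trans (by simpa using hJ₁)
  have hts₂ : s₂.arr 20 0 = ts := (congrFun (hf.arr 20 rfl) 0).trans (by simpa using hts₁)
  have hε₂ : s₂.arr 21 0 = ε := (congrFun (hf.arr 21 rfl) 0).trans (by simpa using hε₁)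
  have hv₂ : s₂.arr 23 0 = F y' := (congrFun (hf.arr 23 rfl) 0).trans (by simp [hy₁])
  have hγ₂ : s₂.arr 29 0 = 1 / (m : ℝ) := (congrFun (hf.arr 29 rfl) 0).trans (by simpa using hγ₁)
  have hb₂ : s₂.vec 0 = 0 := (hf.vec 0 rfl).trans (by simpa using hb₁)
  have hout₂ : s₂.out = [] := (hf.out rfl).trans (by simpa using hout₁)
  clear hf
  obtain ⟨hy₀, hv₂'⟩ := h
  refine Runs.seq (Runs.fill (x := s₂.vec 5) (by decide) hn₂ ?_ fun k₃ => ?_)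
  · intro u t h1 _ h3 _
    simp only [RExpr.eval, RExpr.entry, NExpr.eval, h1, h3 5 (by decide)]
    rfl
  refine Runs.rset (by decide) ⟨y', s₂.vec 5, hy', hy₀, ?_, ?_, ?_, ?_⟩
  · constructor <;> simp [RExpr.eval, RExpr.scalar, NExpr.eval, *]
  · simpa [hb₂] using H.body.zero_mem
  · simpa using hv₂'
  · simpa using hout₂

/-! ### The guarantee and the running time -/

/-- Half a unit of time of the greedy phase with `z = 0` approximates the maximum within a constant
factor, up to the smoothness error. -/
theorem GreedyInv.quarter_le (H : Problem F G L P D lin) {m : ℕ} (hm : 2 ≤ m) {δ : ℝ}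
    (hmδ : (m : ℝ)⁻¹ ≤ δ) {y o : Vec n} (h : GreedyInv F P (D ^ 2 * L) 0 (1 / 2 / m) m y)
    (ho : o ∈ P) : F o / 4 - δ * (D ^ 2 * L) ≤ F y := by
  have hm' : (2 : ℝ) ≤ m := by exact_mod_cast hm
  have h1 := h.value o ho
  have e1 : hprod 0 o = 0 := by ext u; simp
  have e2 : psum 0 o = o := by ext u; simp
  have e3 : (m : ℝ) * (1 / 2 / m) = 1 / 2 := by field_simp
  have e4 : (m : ℝ) * (1 / 2 / m) ^ 2 = 1 / 4 * (m : ℝ)⁻¹ := by field_simp; norm_num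
  rw [e1, e2, e3, e4] at h1
  have h2 := exp_neg_le_pow_div (σ := 1 / 2) (by norm_num) (by norm_num) hm
  have h3 : 1 / 2 ≤ Real.exp (-(1 / 2)) := by
    have := Real.add_one_le_exp (-(1 / 2) : ℝ)
    linarith
  have hFo := (H.grad o (H.body.subset_cube ho)).1
  have h4 := mul_le_mul_of_nonneg_right (h3.trans h2) hFo
  have hS : 0 ≤ D ^ 2 * L := mul_nonneg (sq_nonneg _) H.smooth.1
  have h5 : (m : ℝ)⁻¹ * (D ^ 2 * L) ≤ δ * (D ^ 2 * L) := by gcongr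
  have h6 : 0 ≤ (m : ℝ)⁻¹ * (D ^ 2 * L) := by positivity
  linarith

/-- The grid of the guesses is fine enough, and large enough. -/
theorem exists_guess {X g ε v₀ A : ℝ} {J : ℕ} (hX0 : 0 ≤ X) (hXA : X ≤ 2 * A) (hA : A ≤ 8 * v₀)
    (hv₀ : 0 < v₀) (hε : 0 < ε) (hg : g = ε * v₀) (hJ : 17 ≤ J * ε) :
    ∃ i : ℕ, i < J ∧ i * g ≤ X ∧ X - g ≤ i * g := by
  have hg0 : 0 < g := hg ▸ mul_pos hε hv₀
  have h1 : (⌊X / g⌋₊ : ℝ) * g ≤ X :=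
    (le_div_iff₀ hg0).1 (Nat.floor_le (div_nonneg hX0 hg0.le))
  refine ⟨⌊X / g⌋₊, ?_, h1, ?_⟩
  · have h2 : ((⌊X / g⌋₊ : ℝ) * ε) * v₀ ≤ 16 * v₀ := by rw [mul_assoc, ← hg]; linarith
    have h3 := le_of_mul_le_mul_right h2 hv₀
    have h4 : (⌊X / g⌋₊ : ℝ) * ε < J * ε := by linarith
    exact_mod_cast lt_of_mul_lt_mul_right h4 hε.le
  · have := (div_lt_iff₀ hg0).1 (Nat.lt_floor_add_one (X / g))
    linarith

/-- The right guesses are obtained by rounding down to the grid the value `F (y₀ ⊕ o)` and the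
positive part of `ρ (F (z ⊕ o) - ε F o)`, where `ρ` is `(1 - t_s / m) ^ m`. For them, the second
phase either emits a damaging local maximum or reaches the value claimed in the first
alternative. -/
theorem guarantee (H : Problem F G L P D lin) {ts ε δ : ℝ} {z : Vec n} (hz : z ∈ P)
    (hts0 : 0 < ts) (hts1 : ts < 1) (hε0 : 0 < ε) {m T J : ℕ} (hm2 : 2 ≤ m)
    (hmε : (m : ℝ)⁻¹ ≤ ε) (hmδ : (m : ℝ)⁻¹ ≤ δ) (hT : 9 * m ≤ T * ε) (hJ : 17 ≤ J * ε)
    {y' y₀ : Vec n} (hy' : GreedyInv F P (D ^ 2 * L) 0 (1 / 2 / m) m y')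
    (hy₀ : GreedyInv F P (D ^ 2 * L) z (ts / m) m y₀) {s : State n}
    (hs : SearchState F P L D z y₀ ((1 - ts / m) ^ m) ((1 - ts) / m) ε δ (ε * F y')
      (T * (1 / m * (ε * F y'))) m J J 0 s)
    {o : Vec n} (ho : o ∈ P) (hmax : ∀ x ∈ P, F x ≤ F o) :
    LargeValue 1000 ts ε δ L D F z o (s.vec 0) ∨
      ∃ x ∈ s.out, DamagingLocalMax 1000 ε δ L D F z o x := by
  have hm' : (2 : ℝ) ≤ m := by exact_mod_cast hm2
  have hS : 0 ≤ D ^ 2 * L := mul_nonneg (sq_nonneg _) H.smooth.1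
  have hoc := H.body.subset_cube ho
  have hzc := H.body.subset_cube hz
  have hA : 0 ≤ F o := (H.grad o hoc).1
  have hY0 : 0 ≤ F (hprod z o) := (H.grad _ (hprod_mem_cube hzc hoc)).1
  have hYA : F (hprod z o) ≤ F o := hmax _ (H.body.down_closed z hz _ fun u =>
    ⟨mul_nonneg (hzc u).1 (hoc u).1, mul_le_of_le_one_right (hzc u).1 (hoc u).2⟩)
  have hZ0 : 0 ≤ F (psum z o) := (H.grad _ (psum_mem_cube hzc hoc)).1
  have hZA := H.dr.psum_le_two_mul H.grad H.body ho hmax hz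
  have hSe : δ * D ^ 2 * L = δ * (D ^ 2 * L) := by ring
  have hbest : 0 ≤ F (s.vec 0) := (H.grad _ (H.body.subset_cube hs.best_mem)).1
  rw [LargeValue, hSe]
  by_cases hsmall : F o ≤ 100 * (δ * (D ^ 2 * L))
  · exact Or.inl (large_value_of_small hts0 hts1 hε0 hA hY0 hZ0 hZA hsmall hbest)
  have hδS : 0 ≤ δ * (D ^ 2 * L) := mul_nonneg ((inv_nonneg.2 (by linarith)).trans hmδ) hS
  -- The value `F y'` is within a constant factor of `F o`.
  have hquarter := hy'.quarter_le H hm2 hmδ ho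
  have hy'P : y' ∈ P := hy'.scaled.mem H.body
    (by rw [mul_div_cancel₀ _ (by linarith)]; norm_num) hy'.nonneg
  have hvA : F y' ≤ F o := hmax y' hy'P
  generalize hv₀ : F y' = v₀ at *
  have hv0 : 0 < v₀ := by linarith
  have hA8 : F o ≤ 8 * v₀ := by linarith
  have hη : ts / m < 1 := by rw [div_lt_one (by linarith)]; linarith
  set q := (1 - ts / m) ^ m with hq
  have hq0 : 0 ≤ q := pow_nonneg (by linarith) _
  have hq1 : q ≤ 1 := pow_le_one₀ (by linarith) (sub_le_self _ (by positivity))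
  have hy₀P : y₀ ∈ P := hy₀.scaled.mem H.body
    (by rw [mul_div_cancel₀ _ (by linarith)]; exact hts1.le) hy₀.nonneg
  have hy₀c := H.body.subset_cube hy₀P
  have hX0 : 0 ≤ F (psum y₀ o) := (H.grad _ (psum_mem_cube hy₀c hoc)).1
  have hXA := H.dr.psum_le_two_mul H.grad H.body ho hmax hy₀P
  have hXl := H.dr.psum_ge_sub H.grad hoc hzc hy₀.nonneg hy₀.le (by linarith) (by linarith)
  have hgA : ε * v₀ ≤ ε * F o := by gcongr
  obtain ⟨i, hi, hi1, hi2⟩ := exists_guess hX0 hXA hA8 hv0 hε0 rfl hJ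
  have hεA : 0 ≤ ε * F o := by positivity
  have hRA : max 0 (q * (F (psum z o) - ε * F o)) ≤ 2 * F o := by
    refine max_le (by linarith) ?_
    calc q * (F (psum z o) - ε * F o) ≤ q * (2 * F o) := by gcongr; linarith
      _ ≤ 2 * F o := mul_le_of_le_one_left (by linarith) hq1
  obtain ⟨j, hj, hj1, hj2⟩ := exists_guess (le_max_left 0 _) hRA hA8 hv0 hε0 rfl hJ
  have hcomp : Comparable F P z y₀ ε q (ε * v₀) (T * (1 / m * (ε * v₀))) (i * (ε * v₀))
      (j * (ε * v₀)) o := by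
    refine ⟨ho, hmax, ?_, hgA, hi1, hj1⟩
    have h1 : 9 * v₀ ≤ T * (1 / m * (ε * v₀)) := by
      have h2 : 9 * v₀ = (9 * m) * v₀ / m := by field_simp
      have h3 : T * (1 / m * (ε * v₀)) = (T * ε) * v₀ / m := by ring
      rw [h2, h3]
      gcongr
    linarith
  rcases hs.found i j (Or.inl ⟨hi, hj⟩) o hcomp with h | h
  · exact Or.inr h
  · refine Or.inl ?_
    have hf := hy₀.value o ho
    have hF0 : 0 ≤ (1 - q) * F 0 :=
      mul_nonneg (by linarith) (H.grad 0 zero_mem_cube).1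
    have hg0 : 0 ≤ ε * v₀ := by positivity
    have := large_value_arith hts0 hts1 hε0 hm2 hmε hmδ hY0 hYA hZ0 hZA hS
      (H.grad y₀ hy₀c).1 (hmax y₀ hy₀P) (mul_nonneg (Nat.cast_nonneg i) hg0)
      (mul_nonneg (Nat.cast_nonneg j) hg0) (hj1.trans hRA)
      (by rw [← hq]; linarith) (by rw [← hq]; linarith)
      (by rw [← hq]; linarith [le_max_right 0 (q * (F (psum z o) - ε * F o))]) h
    have h3 : 0 ≤ Real.exp (-1) * (ε * F o) := mul_nonneg (Real.exp_pos _).le hεA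
    linarith

end

theorem exists_least (p : ℕ → Prop) (h : ∃ k, p k) : ∃ k, p k ∧ ∀ j < k, ¬ p j := by
  classical
  exact ⟨Nat.find h, Nat.find_spec h, fun _ hj => Nat.find_min h hj⟩

/-- For fixed `ε` and `d`, the number of steps of the program is polynomial in `n` and `1 / δ`: `J`
is bounded, `m` and `T` are linear in `1 / δ`, and a time unit is polynomial in `n`. -/
theorem time_bound (ε : ℝ) (hε : 0 < ε) (hε1 : ε < 1 / 2) (d : ℕ) : ∃ (C : ℝ) (p : ℕ),
    ∀ (δ : ℝ) (n m T J : ℕ), 0 < δ → δ < 1 → (m : ℝ) ≤ δ⁻¹ + ε⁻¹ + 1 →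
      (T : ℝ) ≤ 9 * m * ε⁻¹ + 1 → (J : ℝ) ≤ 18 * ε⁻¹ →
      (((m * 14 + T * 2 + J * 2 + 18 + (J * (J * (m * (T * 9 + 14) + 11) + 4) + 2))
        * timeUnit n d : ℕ) : ℝ) ≤ C * ((n : ℝ) + δ⁻¹) ^ p := by
  obtain ⟨E, hE⟩ : ∃ E, E = ε⁻¹ := ⟨_, rfl⟩
  have hE2 : 2 ≤ E := by
    rw [hE, le_inv_comm₀ (by norm_num) hε]; linarith
  rw [← hE]
  set B : ℝ := 30 * E with hB
  refine ⟨76 * B ^ 5 * (100 * 3 ^ (d + 1)), d + 3, fun δ n m T J hδ0 hδ1 hm hT hJ => ?_⟩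
  have hδ : 1 ≤ δ⁻¹ := (one_le_inv₀ hδ0).2 hδ1.le
  obtain ⟨X, hX⟩ : ∃ X, X = (n : ℝ) + δ⁻¹ := ⟨_, rfl⟩
  have hn0 : (0 : ℝ) ≤ n := Nat.cast_nonneg n
  have hX1 : 1 ≤ X := by linarith
  rw [← hX]
  have hB1 : 1 ≤ B := by linarith
  have hEX : E ≤ E * X := le_mul_of_one_le_right (by linarith) hX1
  have hEX' : 2 * X ≤ E * X := by gcongr
  have hm' : (m : ℝ) ≤ 2 * (E * X) := by linarith
  have hmB : (m : ℝ) ≤ B * X := by rw [hB]; linarith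
  have hTB : (T : ℝ) ≤ B ^ 2 * X := by
    have h1 : 9 * (m : ℝ) * E ≤ 9 * (2 * (E * X)) * E := by gcongr
    have h2 : 1 ≤ E ^ 2 * X := one_le_mul_of_one_le_of_one_le (by nlinarith) hX1
    rw [hB]
    nlinarith
  have hJB : (J : ℝ) ≤ B := by rw [hB]; linarith
  have hunit : (timeUnit n d : ℝ) ≤ 100 * 3 ^ (d + 1) * X ^ (d + 1) := by
    rw [timeUnit, mul_assoc, ← mul_pow]
    push_cast
    gcongr
    linarith
  have hsteps : (m : ℝ) * 14 + T * 2 + J * 2 + 18 + (J * (J * (m * (T * 9 + 14) + 11) + 4) + 2)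
      ≤ 76 * B ^ 5 * X ^ 2 := by
    have h1 : ∀ i j : ℕ, i ≤ 5 → j ≤ 2 → B ^ i * X ^ j ≤ B ^ 5 * X ^ 2 := fun i j hi hj => by
      gcongr
    have h2 := h1 1 1 (by omega) (by omega)
    have h3 := h1 2 1 (by omega) (by omega)
    have h4 := h1 1 0 (by omega) (by omega)
    have h5 := h1 0 0 (by omega) (by omega)
    have h6 := h1 3 1 (by omega) (by omega)
    have h7 := h1 2 0 (by omega) (by omega)
    calc _ ≤ B * X * 14 + B ^ 2 * X * 2 + B * 2 + 18
          + (B * (B * (B * X * (B ^ 2 * X * 9 + 14) + 11) + 4) + 2) := by gcongr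
      _ ≤ _ := by linarith
  calc _ ≤ (76 * B ^ 5 * X ^ 2) * (100 * 3 ^ (d + 1) * X ^ (d + 1)) := by
        push_cast
        gcongr
    _ = _ := by ring

end FWMCG

open FWMCG in
theorem theorem3p1 :
    ∃ (prog : FWMCG.Cmd) (c : ℝ), 0 < c ∧
      ∀ (d : ℕ) (ts ε : ℝ), 0 < ts → ts < 1 → 0 < ε → ε < 1 / 2 →
      ∃ (C : ℝ) (p : ℕ),
      ∀ (δ : ℝ), 0 < δ → δ < 1 →
      ∀ (n : ℕ) (F : FWMCG.Vec n → ℝ) (G : FWMCG.Vec n → FWMCG.Vec n) (L : ℝ)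
        (P : Set (FWMCG.Vec n)) (D : ℝ)
        (lin : List (FWMCG.Vec n × ℝ) → FWMCG.Vec n → Option (FWMCG.Vec n))
        (z : FWMCG.Vec n),
        FWMCG.NonnegWithGradient F G → FWMCG.Smooth L G → FWMCG.DRSubmodular F →
        FWMCG.DownClosedBody P → FWMCG.HasDiameter P D → FWMCG.MetaSolves P lin →
        z ∈ P →
        ∃ (s : FWMCG.State n) (t : ℕ),
          FWMCG.Exec ⟨F, G, lin⟩ d prog (FWMCG.inputState ts ε δ z) s t ∧
          (t : ℝ) ≤ C * ((n : ℝ) + δ⁻¹) ^ p ∧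
          s.vec 0 ∈ P ∧ (∀ x ∈ s.out, x ∈ P) ∧
          (∃ K m : ℕ, s.out.length = K * m ∧
            (K : ℝ) ≤ c * ε⁻¹ ^ 3 ∧ (m : ℝ) ≤ c * (δ⁻¹ + ε⁻¹)) ∧
          ∀ o ∈ P, (∀ x ∈ P, F x ≤ F o) →
            FWMCG.LargeValue c ts ε δ L D F z o (s.vec 0) ∨
            ∃ x ∈ s.out, FWMCG.DamagingLocalMax c ε δ L D F z o x := by
  refine ⟨.seq setup search, 1000, by norm_num, fun d ts ε hts0 hts1 hε0 hε1 => ?_⟩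
  obtain ⟨C, p, hC⟩ := time_bound ε hε0 hε1 d
  refine ⟨C, p, fun δ hδ0 hδ1 n F G L P D lin z hG hL hF hP hD hlin hz => ?_⟩
  have H : Problem F G L P D lin := ⟨hG, hL, hF, hP, hD, hlin⟩
  have hδi : 1 ≤ δ⁻¹ := (one_le_inv₀ hδ0).2 hδ1.le
  have hεi : 2 ≤ ε⁻¹ := by rw [le_inv_comm₀ (by norm_num) hε0]; linarith
  obtain ⟨m, hm, hm'⟩ := exists_least (fun k : ℕ => 1 ≤ k * δ ∧ 1 ≤ k * ε) ⟨⌈δ⁻¹ + ε⁻¹⌉₊, by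
    have := Nat.le_ceil (δ⁻¹ + ε⁻¹)
    constructor
    · rw [← div_le_iff₀ hδ0, one_div]; linarith
    · rw [← div_le_iff₀ hε0, one_div]; linarith⟩
  obtain ⟨T, hT, hT'⟩ := exists_least (fun k : ℕ => 9 * (m : ℝ) ≤ k * ε) ⟨⌈9 * m / ε⌉₊, by
    rw [← div_le_iff₀ hε0]; exact Nat.le_ceil _⟩
  obtain ⟨J, hJ, hJ'⟩ := exists_least (fun k : ℕ => 17 ≤ (k : ℝ) * ε) ⟨⌈17 / ε⌉₊, by
    rw [← div_le_iff₀ hε0]; exact Nat.le_ceil _⟩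
  have hm2 : 2 < m := by
    have : 2 < (m : ℝ) := by
      by_contra! h
      nlinarith [hm.2]
    exact_mod_cast this
  have hm0 : (2 : ℝ) < m := by exact_mod_cast hm2
  have hmδ : (m : ℝ)⁻¹ ≤ δ := by
    rw [inv_le_iff_one_le_mul₀ (by linarith), mul_comm]; exact hm.1
  have hmε : (m : ℝ)⁻¹ ≤ ε := by
    rw [inv_le_iff_one_le_mul₀ (by linarith), mul_comm]; exact hm.2
  have hmle : (m : ℝ) ≤ δ⁻¹ + ε⁻¹ + 1 := by
    by_contra! h
    refine hm' (m - 1) (by omega) ?_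
    rw [Nat.cast_sub (by omega), Nat.cast_one, ← div_le_iff₀ hδ0, ← div_le_iff₀ hε0, one_div,
      one_div]
    constructor <;> linarith
  have hTle : (T : ℝ) ≤ 9 * m * ε⁻¹ + 1 := by
    by_contra! h
    have h0 : 0 ≤ 9 * (m : ℝ) * ε⁻¹ := by positivity
    have hT0 : 1 ≤ T := by
      have : (1 : ℝ) ≤ T := by linarith
      exact_mod_cast this
    refine hT' (T - 1) (by omega) ?_
    rw [Nat.cast_sub hT0, Nat.cast_one, ← div_le_iff₀ hε0, div_eq_mul_inv]
    linarith
  have hJle : (J : ℝ) ≤ 18 * ε⁻¹ := by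
    by_contra! h
    have hJ0 : 1 ≤ J := by
      have : (1 : ℝ) ≤ J := by linarith
      exact_mod_cast this
    refine hJ' (J - 1) (by omega) ?_
    rw [Nat.cast_sub hJ0, Nat.cast_one, ← div_le_iff₀ hε0, div_eq_mul_inv]
    linarith
  have hη1 : (1 - ts) / m < 1 := by rw [div_lt_one (by linarith)]; linarith
  have hts' : ts / m < 1 := by rw [div_lt_one (by linarith)]; linarith
  have hinv : ∀ {y₀}, GreedyInv F P (D ^ 2 * L) z (ts / m) m y₀ →
      HybridInv P (m * (ts / m)) ((1 - ts / m) ^ m) ((1 - ts) / m) 0 y₀ := fun {y₀} h => by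
    refine ⟨h.nonneg, fun u => ?_, by simpa using h.scaled⟩
    have h1 : 0 ≤ (1 - (1 - ts / m) ^ m) * z u :=
      mul_nonneg (sub_nonneg.2 (pow_le_one₀ (by linarith) (sub_le_self _ (by positivity))))
        (hP.subset_cube hz u).1
    have := h.le u
    rw [pow_zero, mul_one]
    linarith
  obtain ⟨s, t, hexec, ht, y', y₀, hy', hy₀, hs⟩ :=
    Runs.seq (c₁ := setup) (c₂ := search)
      (N₂ := J * (J * (m * (T * 9 + 14) + 11) + 4) + 2) (Q := fun s =>
      ∃ y' y₀, GreedyInv F P (D ^ 2 * L) 0 (1 / 2 / m) m y' ∧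
        GreedyInv F P (D ^ 2 * L) z (ts / m) m y₀ ∧
        SearchState F P L D z y₀ ((1 - ts / m) ^ m) ((1 - ts) / m) ε δ (ε * F y')
          (T * (1 / m * (ε * F y'))) m J J 0 s)
      ((setup_spec (d := d) H hz hts0 hts1 hm2.le hm hm' hT hT' hJ hJ').mono le_rfl
        fun s₁ _ ⟨y', y₀, hy', hy₀, hr, hb, hv, hout⟩ =>
          (search_spec H (τ := m * (ts / m)) (ρ := (1 - ts / m) ^ m) hr
            (div_pos (by linarith) (by linarith)) hη1 (by omega)
            (by rwa [one_div]) hε0 (by positivity)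
            (le_of_eq (by field_simp; ring))
            (pow_nonneg (by linarith) _)
            (pow_le_one₀ (by linarith) (sub_le_self _ (by positivity)))
            (hinv hy₀) hb hv hout).mono le_rfl
              fun s₂ _ h => ⟨y', y₀, hy', hy₀, h⟩)
  refine ⟨s, t, hexec, ?_, hs.best_mem, hs.out_mem, ⟨J * J, m, by simpa using hs.length, ?_, ?_⟩,
    fun o ho hmax => guarantee H hz hts0 hts1 hε0 hm2.le hmε hmδ hT hJ hy' hy₀ hs ho hmax⟩
  · exact le_trans (by exact_mod_cast ht) (hC δ n m T J hδ0 hδ1 hmle hTle hJle)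
  · push_cast
    have h1 : (J : ℝ) * J ≤ (18 * ε⁻¹) * (18 * ε⁻¹) := by gcongr
    have h2 : 0 ≤ ε⁻¹ ^ 2 * (ε⁻¹ - 2) := mul_nonneg (by positivity) (by linarith)
    nlinarith
  · linarith
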